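/- A \emph{fuzzy set} on a set $X$ is a function $\mu:X\to[0,1]$; write $\mu(X)=\bigvee_{x\in X}\mu(x)$ and $\mathrm{Supp}(\mu)=\{x:\mu(x)>0\}$. A \emph{fuzzy transition system} $\mathcal M=(S,A,\delta)$ consists of finite sets $S$ (states) and $A$ (labels) and a map $\delta$ that assigns to each $(s,a)\in S\times A$ a set of fuzzy sets on $S$; as an input to an algorithm, every $\delta(s,a)$ is finite and all its members are rational-valued. A \emph{pseudo-ultrametric} on $X$ is a function $d:X\times X\to[0,1]$ with $d(x,x)=0$, $d(x,y)=d(y,x)$ and $d(x,z)\le d(x,y)\vee d(y,z)$. For a pseudo-ultrametric $d$ on $S$ and fuzzy sets $\mu,\eta$ on $S$ let $\hat d(\mu,\eta)=1$ if $\mu(S)\ne\eta(S)$, and otherwise let $\hat d(\mu,\eta)$ be the minimum of $\bigvee_{s,t}(d(s,t)\wedge x_{st})$ over all $x_{st}\ge 0$ with $\bigvee_t x_{st}=\mu(s)$ for all $s$ and $\bigvee_s x_{st}=\eta(t)$ for all $t$. For sets $Y,Z$ of fuzzy sets let $H_{\hat d}(Y,Z)=\bigvee_{\mu\in Y}\bigwedge_{\eta\in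 Z}\hat d(\mu,\eta)\vee\bigvee_{\eta\in Z}\bigwedge_{\mu\in Y}\hat d(\mu,\eta)$, with suprema and infima taken in $[0,1]$ (so $\bigwedge\emptyset=1$ and $\bigvee\emptyset=0$). The functional $\Delta(d)(s,t)=\bigvee_{a\in A}H_{\hat d}(\delta(s,a),\delta(t,a))$ is monotone on the complete lattice of pseudo-ultrametrics on $S$ with the pointwise order, and the \emph{non-discounted behavioural distance} $d_f^1$ is its least fixpoint. Put $|\mathcal M|=|S|+\sum_{s,a,\mu\in\delta(s,a)}|\mathrm{Supp}(\mu)|$ and $\|\mathcal M\|=|S|+\sum_{s,a,\mu\in\delta(s,a)}\sum_{x\in\mathrm{Supp}(\mu)}\|\mu(x)\|$, where $\|q\|$ is the number of bits of the rational number $q$ written as a fraction in lowest terms, and let $e(\mathcal M)$ be the number of triples $(s,a,\mu)$ with $\mu\in\delta(s,a)$ and $\mathrm{Supp}(\mu)=\emptyset$ (so $e(\mathcal M)=0$ when no transition leads to the empty fuzzy set). \textbf{Theorem.} The distance $d_f^1(s,t)$ can be computed in strongly polynomial time: there are a program for the unit-cost arithmetic random access machine (whose registers and memory cells hold rational numbers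 and whose steps are $+,-,\times,\div$, comparisons, assignments, and loads and stores with indirect addressing) and polynomials $p,q$ such that, for every fuzzy transition system $\mathcal M$ as above and all states $s,t$ of $\mathcal M$, the program, started on any listing of the transitions of $\mathcal M$ together with $s$ and $t$, halts with output $d_f^1(s,t)$ after at most $p(|\mathcal M|+e(\mathcal M))$ steps, while the space used, in bits, never exceeds $q(\|\mathcal M\|+e(\mathcal M))$. -/

import Mathlib

/-! ## Fuzzy sets and fuzzy transition systems -/

/-- A fuzzy subset of `X`: a membership function `X → [0,1]`. -/
abbrev FuzzySet (X : Type*) : Type _ := X → unitInterval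

/-- A fuzzy transition system with states `S` and labels `A`. -/
structure FTS (S A : Type*) where
  δ : S → A → Set (FuzzySet S)

/-! ## Pseudo-ultrametrics, the lifting, the Hausdorff distance, the functional `Δ` -/

/-- A `[0,1]`-valued pseudo-ultrametric. -/
@[ext]
structure PseudoUltrametric (X : Type*) where
  dist : X → X → unitInterval
  dist_self : ∀ x, dist x x = 0
  dist_comm : ∀ x y, dist x y = dist y x
  dist_triangle : ∀ x y z, dist x z ≤ dist x y ⊔ dist y z

namespace PseudoUltrametric

/-- The pointwise order. -/
instance (X : Type*) : PartialOrder (PseudoUltrametric X) :=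
  PartialOrder.lift PseudoUltrametric.dist (fun _ _ h => PseudoUltrametric.ext h)

/-- Suprema are pointwise. -/
noncomputable instance (X : Type*) : SupSet (PseudoUltrametric X) where
  sSup D :=
    { dist := fun x y => ⨆ d ∈ D, d.dist x y
      dist_self := fun x => by
        refine le_antisymm (iSup₂_le fun d _ => (d.dist_self x).le) bot_le
      dist_comm := fun x y => by simp only [fun d : PseudoUltrametric X => d.dist_comm x y]
      dist_triangle := fun x y z => by
        refine iSup₂_le fun d hd => (d.dist_triangle x y z).trans ?_
        exact sup_le_sup (le_iSup₂_of_le d hd le_rfl) (le_iSup₂_of_le d hd le_rfl) }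

/-- Pseudo-ultrametrics under the pointwise order form a complete lattice (suprema are pointwise,
infima in general are not). -/
noncomputable instance (X : Type*) : CompleteLattice (PseudoUltrametric X) :=
  completeLatticeOfSup _ (fun D => by
    constructor
    · intro d hd x y
      exact le_iSup₂_of_le (f := fun (d : PseudoUltrametric X) (_ : d ∈ D) => d.dist x y) d hd le_rfl
    · intro e he x y
      exact iSup₂_le fun d hd => he hd x y)

end PseudoUltrametric

/-- The feasible region of the lifting problem: `x` has row suprema `μ` and column suprema `η`.
(Any nonnegative real solution of these equations automatically takes values in `[0,1]`.) -/
def IsCoupling {S : Type*} (μ η : FuzzySet S) (x : S → S → unitInterval) : Prop :=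
  (∀ s, ⨆ t, x s t = μ s) ∧ (∀ t, ⨆ s, x s t = η t)

open Classical in
/-- The value of the lifting: `1` if `μ(S) ≠ η(S)`, and otherwise the least value of
`⋁_{s,t} (d(s,t) ∧ x_{st})` over the feasible region. -/
noncomputable def liftDist {S : Type*} (d : S → S → unitInterval) (μ η : FuzzySet S) :
    unitInterval :=
  if ⨆ s, μ s = ⨆ s, η s then
    ⨅ (x : S → S → unitInterval) (_ : IsCoupling μ η x), ⨆ s, ⨆ t, d s t ⊓ x s t
  else 1

theorem liftDist_self {S : Type*} (d : PseudoUltrametric S) (μ : FuzzySet S) :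
    liftDist d.dist μ μ = 0 := by
  classical
  unfold liftDist
  rw [if_pos rfl]
  refine le_antisymm ?_ bot_le
  refine iInf₂_le_of_le (fun s t => if s = t then μ s else 0) ⟨fun s => ?_, fun t => ?_⟩ ?_
  · refine le_antisymm (iSup_le fun t => ?_) (le_iSup_of_le s (by simp))
    dsimp only
    split_ifs
    · exact le_rfl
    · exact bot_le
  · refine le_antisymm (iSup_le fun s => ?_) (le_iSup_of_le t (by simp))
    dsimp only
    split_ifs with h
    · rw [h]
    · exact bot_le
  · refine iSup₂_le fun s t => ?_
    dsimp only
    split_ifs with h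
    · subst h
      exact inf_le_left.trans (d.dist_self s).le
    · exact inf_le_right

theorem liftDist_le_symm {S : Type*} (d : PseudoUltrametric S) (μ η : FuzzySet S) :
    liftDist d.dist μ η ≤ liftDist d.dist η μ := by
  unfold liftDist
  by_cases h : ⨆ s, μ s = ⨆ s, η s
  · rw [if_pos h, if_pos h.symm]
    refine le_iInf₂ fun x hx => ?_
    refine iInf₂_le_of_le (fun s t => x t s) ⟨hx.2, hx.1⟩ ?_
    refine iSup₂_le fun s t => ?_
    rw [d.dist_comm s t]
    exact le_iSup₂_of_le (f := fun s t => d.dist s t ⊓ x s t) t s le_rfl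
  · rw [if_neg h, if_neg (fun h' => h h'.symm)]

theorem liftDist_triangle {S : Type*} (d : PseudoUltrametric S) (μ η ν : FuzzySet S) :
    liftDist d.dist μ ν ≤ liftDist d.dist μ η ⊔ liftDist d.dist η ν := by
  unfold liftDist
  by_cases h₁ : ⨆ s, μ s = ⨆ s, η s
  swap
  · rw [if_neg h₁]
    exact le_sup_of_le_left unitInterval.le_one'
  by_cases h₂ : ⨆ s, η s = ⨆ s, ν s
  swap
  · rw [if_neg h₂]
    exact le_sup_of_le_right unitInterval.le_one'
  rw [if_pos h₁, if_pos h₂, if_pos (h₁.trans h₂), iInf₂_sup_eq]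
  refine le_iInf₂ fun x hx => ?_
  rw [sup_iInf₂_eq]
  refine le_iInf₂ fun y hy => ?_
  refine iInf₂_le_of_le (fun s u => ⨆ t, x s t ⊓ y t u) ⟨fun s => ?_, fun u => ?_⟩ ?_
  · rw [iSup_comm, ← hx.1 s]
    refine iSup_congr fun t => ?_
    rw [← inf_iSup_eq, hy.1 t, inf_eq_left, ← hx.2 t]
    exact le_iSup (fun s => x s t) s
  · rw [iSup_comm, ← hy.2 u]
    refine iSup_congr fun t => ?_
    rw [← iSup_inf_eq, hx.2 t, inf_eq_right, ← hy.1 t]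
    exact le_iSup (fun u => y t u) u
  · refine iSup₂_le fun s u => ?_
    rw [inf_iSup_eq]
    refine iSup_le fun t => ?_
    have hxt : d.dist s t ⊓ x s t ≤ ⨆ s, ⨆ t, d.dist s t ⊓ x s t :=
      le_iSup₂_of_le (f := fun s t => d.dist s t ⊓ x s t) s t le_rfl
    have hyt : d.dist t u ⊓ y t u ≤ ⨆ s, ⨆ t, d.dist s t ⊓ y s t :=
      le_iSup₂_of_le (f := fun s t => d.dist s t ⊓ y s t) t u le_rfl
    refine le_trans (inf_le_inf_right _ (d.dist_triangle s t u)) ?_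
    rw [inf_sup_right]
    exact sup_le_sup ((inf_le_inf_left _ inf_le_left).trans hxt)
      ((inf_le_inf_left _ inf_le_right).trans hyt)

/-- The lifting `d̂` of a pseudo-ultrametric `d` on states to fuzzy sets. -/
noncomputable def PseudoUltrametric.lift {S : Type*} (d : PseudoUltrametric S) :
    PseudoUltrametric (FuzzySet S) where
  dist := liftDist d.dist
  dist_self := liftDist_self d
  dist_comm μ η := le_antisymm (liftDist_le_symm d μ η) (liftDist_le_symm d η μ)
  dist_triangle := liftDist_triangle d

/-- The Hausdorff distance. Infima and suprema are taken in `[0,1]`, so that `d(x, ∅) = 1` and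
`H(∅, ∅) = 0`. -/
noncomputable def hausdorffDist {X : Type*} (d : X → X → unitInterval) (Y Z : Set X) :
    unitInterval :=
  (⨆ y ∈ Y, ⨅ z ∈ Z, d y z) ⊔ (⨆ z ∈ Z, ⨅ y ∈ Y, d z y)

theorem iSup_iInf_dist_triangle {X : Type*} (d : PseudoUltrametric X) (Y Z W : Set X) :
    (⨆ y ∈ Y, ⨅ w ∈ W, d.dist y w) ≤
      (⨆ y ∈ Y, ⨅ z ∈ Z, d.dist y z) ⊔ (⨆ z ∈ Z, ⨅ w ∈ W, d.dist z w) := by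
  refine iSup₂_le fun y hy => ?_
  refine le_trans ?_ (sup_le_sup_right
    (le_iSup₂_of_le (f := fun y (_ : y ∈ Y) => ⨅ z ∈ Z, d.dist y z) y hy le_rfl) _)
  rw [iInf₂_sup_eq]
  refine le_iInf₂ fun z hz => ?_
  refine le_trans ?_ (sup_le_sup_left
    (le_iSup₂_of_le (f := fun z (_ : z ∈ Z) => ⨅ w ∈ W, d.dist z w) z hz le_rfl) _)
  rw [sup_iInf₂_eq]
  exact iInf₂_mono fun w _ => d.dist_triangle y z w

/-- The Hausdorff distance as a pseudo-ultrametric on the power set. -/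
noncomputable def PseudoUltrametric.hausdorff {X : Type*} (d : PseudoUltrametric X) :
    PseudoUltrametric (Set X) where
  dist := hausdorffDist d.dist
  dist_self Y := by
    refine le_antisymm (sup_le ?_ ?_) bot_le <;>
    exact iSup₂_le fun y hy => iInf₂_le_of_le y hy (d.dist_self y).le
  dist_comm Y Z := sup_comm _ _
  dist_triangle Y Z W := by
    refine sup_le ((iSup_iInf_dist_triangle d Y Z W).trans
      (sup_le_sup le_sup_left le_sup_left)) ?_
    refine (iSup_iInf_dist_triangle d W Z Y).trans ?_
    rw [sup_comm]
    exact sup_le_sup le_sup_right le_sup_right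

theorem liftDist_mono {S : Type*} {d e : PseudoUltrametric S} (h : d ≤ e) (μ η : FuzzySet S) :
    liftDist d.dist μ η ≤ liftDist e.dist μ η := by
  unfold liftDist
  split_ifs
  · exact iInf₂_mono fun x _ => iSup₂_mono fun s t => inf_le_inf_right _ (h s t)
  · exact le_rfl

theorem hausdorffDist_mono {X : Type*} {d e : PseudoUltrametric X} (h : d ≤ e) (Y Z : Set X) :
    hausdorffDist d.dist Y Z ≤ hausdorffDist e.dist Y Z :=
  sup_le_sup (iSup₂_mono fun y _ => iInf₂_mono fun z _ => h y z)
    (iSup₂_mono fun z _ => iInf₂_mono fun y _ => h z y)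

namespace FTS

/-- The monotone functional `Δ(d)(s,t) = γ · ⋁_a H_{d̂}(δ(s,a), δ(t,a))` on pseudo-ultrametrics. -/
noncomputable def Delta {S A : Type*} (M : FTS S A) (γ : unitInterval) :
    PseudoUltrametric S →o PseudoUltrametric S where
  toFun d :=
    { dist := fun s t => γ * ⨆ a, d.lift.hausdorff.dist (M.δ s a) (M.δ t a)
      dist_self := fun s => by
        have h : (⨆ a, d.lift.hausdorff.dist (M.δ s a) (M.δ s a)) = 0 :=
          le_antisymm (iSup_le fun a => (d.lift.hausdorff.dist_self _).le) bot_le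
        rw [h, mul_zero]
      dist_comm := fun s t => by
        simp only [fun a => d.lift.hausdorff.dist_comm (M.δ s a) (M.δ t a)]
      dist_triangle := fun s t u => by
        have h : (⨆ a, d.lift.hausdorff.dist (M.δ s a) (M.δ u a)) ≤
            (⨆ a, d.lift.hausdorff.dist (M.δ s a) (M.δ t a)) ⊔
              (⨆ a, d.lift.hausdorff.dist (M.δ t a) (M.δ u a)) :=
          iSup_le fun a => (d.lift.hausdorff.dist_triangle _ (M.δ t a) _).trans
            (sup_le_sup (le_iSup (fun a => d.lift.hausdorff.dist (M.δ s a) (M.δ t a)) a)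
              (le_iSup (fun a => d.lift.hausdorff.dist (M.δ t a) (M.δ u a)) a))
        have hm : Monotone fun x : unitInterval => γ * x := fun x y hxy =>
          mul_le_mul_of_nonneg_left (a := (γ : ℝ)) hxy γ.2.1
        exact (hm h).trans (hm.map_sup _ _).le }
  monotone' d e h s t :=
    mul_le_mul_of_nonneg_left (a := (γ : ℝ))
      (iSup_mono fun a => hausdorffDist_mono (d := d.lift) (e := e.lift)
        (fun μ η => liftDist_mono h μ η) (M.δ s a) (M.δ t a)) γ.2.1

/-- The behavioural distance `d_f^γ`: the least fixpoint of `Δ`, that is, the infimum in the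
lattice of pseudo-ultrametrics of all `d` with `Δ(d) ≤ d`. -/
noncomputable def behDist {S A : Type*} (M : FTS S A) (γ : unitInterval) (s t : S) :
    unitInterval :=
  (OrderHom.lfp (M.Delta γ)).dist s t

end FTS

/-! ## Finitely presented rational systems and their sizes -/

/-- A fuzzy transition system in which every `δ(s,a)` is a finite set of rational-valued fuzzy
sets, so that it can be given to an algorithm. -/
structure RatFTS (S A : Type*) where
  tr : S → A → Finset (S → ℚ)
  mem_unit : ∀ s a, ∀ μ ∈ tr s a, ∀ x, 0 ≤ μ x ∧ μ x ≤ 1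

/-- The number of bits of a rational number, written as a fraction in lowest terms. -/
def ratBits (q : ℚ) : ℕ := q.num.natAbs.size + q.den.size

namespace RatFTS

variable {S A : Type*}

/-- The underlying fuzzy transition system. -/
def toFTS (M : RatFTS S A) : FTS S A where
  δ s a := {ν | ∃ μ ∈ M.tr s a, ∀ x, (ν x : ℝ) = (μ x : ℝ)}

/-- `|M| = |S| + ∑_{s, a, μ ∈ δ(s,a)} |Supp(μ)|`. -/
def size [Fintype S] [Fintype A] (M : RatFTS S A) : ℕ :=
  Fintype.card S + ∑ s, ∑ a, ∑ μ ∈ M.tr s a, (Finset.univ.filter fun x => 0 < μ x).card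

/-- `‖M‖ = |S| + ∑_{s, a, μ ∈ δ(s,a)} ‖Supp(μ)‖`, where `‖Supp(μ)‖` is the number of bits of the
positive membership degrees of `μ`. -/
def bitSize [Fintype S] [Fintype A] (M : RatFTS S A) : ℕ :=
  Fintype.card S +
    ∑ s, ∑ a, ∑ μ ∈ M.tr s a, ∑ x ∈ Finset.univ.filter (fun x => 0 < μ x), ratBits (μ x)

/-- The number of transitions `s -a-> ∅` into the empty fuzzy set; they have no support and are
thus not seen by `size` and `bitSize`. -/
def numEmpty [Fintype S] [Fintype A] (M : RatFTS S A) : ℕ :=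
  ∑ s, ∑ a, ((M.tr s a).filter fun μ => ∀ x, μ x = 0).card

/-- The labels that occur in some transition. -/
def enabled (M : RatFTS S A) : Set A := {a | ∃ s, (M.tr s a).Nonempty}

/-- The choices made when `M` is written down: a numbering of the states, a numbering of the
labels that occur, and an order in which the transitions are listed. -/
structure Presentation [Fintype S] (M : RatFTS S A) where
  state : S ≃ Fin (Fintype.card S)
  label : A → ℕ
  label_inj : Set.InjOn label M.enabled
  label_lt : ∀ a ∈ M.enabled, label a < M.enabled.ncard
  trans : List (S × A × (S → ℚ))
  trans_nodup : trans.Nodup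
  mem_trans : ∀ s a μ, (s, a, μ) ∈ trans ↔ μ ∈ M.tr s a

/-- The input word for `M` and two states: the number of states, the number of transitions, the
numbers of the two states, and then, for each transition `s -a-> μ`, the number of `s`, the number
of `a` and the membership degrees of all states in `μ`. -/
def Presentation.encode [Fintype S] {M : RatFTS S A} (P : M.Presentation) (s t : S) : List ℚ :=
  [(Fintype.card S : ℚ), (P.trans.length : ℚ), ((P.state s : ℕ) : ℚ), ((P.state t : ℕ) : ℚ)] ++
    P.trans.flatMap fun τ =>
      ((P.state τ.1 : ℕ) : ℚ) :: (P.label τ.2.1 : ℚ) ::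
        List.ofFn fun i : Fin (Fintype.card S) => τ.2.2 (P.state.symm i)

end RatFTS

/-! ## The unit-cost arithmetic random access machine -/

namespace ArithRAM

/-- The arithmetic operations. -/
inductive Op
  | add | sub | mul | div

/-- The comparisons. -/
inductive Cmp
  | le | lt | eq | ne

/-- Instructions. Numbers `r, r₁, r₂, a` are names of registers. -/
inductive Instr
  /-- do nothing -/
  | skip
  /-- `r := q` -/
  | const (r : ℕ) (q : ℚ)
  /-- `r := r₁` -/
  | move (r r₁ : ℕ)
  /-- `r := r₁ ∘ r₂` -/
  | arith (o : Op) (r r₁ r₂ : ℕ)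
  /-- `r := mem[a]`, the memory cell whose address is in register `a` -/
  | load (r a : ℕ)
  /-- `mem[a] := r` -/
  | store (a r : ℕ)

/-- Programs: finite, with structured control flow. -/
inductive Program
  | instr (i : Instr)
  | seq (p q : Program)
  | cond (c : Cmp) (r₁ r₂ : ℕ) (p q : Program)
  | loop (c : Cmp) (r₁ r₂ : ℕ) (p : Program)

/-- A machine state: registers and memory cells with rational contents, almost all of them `0`. -/
structure State where
  reg : ℕ →₀ ℚ
  mem : ℕ →₀ ℚ

namespace State

/-- Write a register. -/
noncomputable def setReg (σ : State) (r : ℕ) (q : ℚ) : State := ⟨σ.reg.update r q, σ.mem⟩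

/-- Write a memory cell. -/
noncomputable def setMem (σ : State) (k : ℕ) (q : ℚ) : State := ⟨σ.reg, σ.mem.update k q⟩

/-- The space in bits: for each register and memory cell in use (that is, not `0`), the length of
its address and the length of its contents. -/
def space (σ : State) : ℕ :=
  (∑ r ∈ σ.reg.support, (r.size + ratBits (σ.reg r))) +
    ∑ k ∈ σ.mem.support, (k.size + ratBits (σ.mem k))

/-- The initial state: the input word is in the memory cells `0, 1, 2, …`, its length is in
register `0`, and everything else is `0`. -/
noncomputable def init (w : List ℚ) : State where
  reg := Finsupp.single 0 (w.length : ℚ)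
  mem := ∑ k ∈ Finset.range w.length, Finsupp.single k (w.getD k 0)

end State

/-- The outcome of an arithmetic operation. -/
def Op.eval : Op → ℚ → ℚ → ℚ
  | .add, x, y => x + y
  | .sub, x, y => x - y
  | .mul, x, y => x * y
  | .div, x, y => x / y

/-- The comparison holds. -/
def Cmp.Holds : Cmp → ℚ → ℚ → Prop
  | .le, x, y => x ≤ y
  | .lt, x, y => x < y
  | .eq, x, y => x = y
  | .ne, x, y => x ≠ y

/-- One instruction leads from `σ` to `σ'`. Division by zero and an address that is not a natural
number have no successor state. -/
inductive Step : Instr → State → State → Prop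
  | skip (σ : State) : Step .skip σ σ
  | const (σ : State) (r : ℕ) (q : ℚ) : Step (.const r q) σ (σ.setReg r q)
  | move (σ : State) (r r₁ : ℕ) : Step (.move r r₁) σ (σ.setReg r (σ.reg r₁))
  | arith (σ : State) (o : Op) (r r₁ r₂ : ℕ) (h : o = Op.div → σ.reg r₂ ≠ 0) :
      Step (.arith o r r₁ r₂) σ (σ.setReg r (o.eval (σ.reg r₁) (σ.reg r₂)))
  | load (σ : State) (r a k : ℕ) (h : σ.reg a = (k : ℚ)) :
      Step (.load r a) σ (σ.setReg r (σ.mem k))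
  | store (σ : State) (a r k : ℕ) (h : σ.reg a = (k : ℚ)) :
      Step (.store a r) σ (σ.setMem k (σ.reg r))

/-- `Run p σ σ' n b`: started in `σ`, the program `p` halts in `σ'` after exactly `n` steps (every
instruction and every test counts as one), and `b` is the largest space of a state on the way. -/
inductive Run : Program → State → State → ℕ → ℕ → Prop
  | instr {i : Instr} {σ σ' : State} (h : Step i σ σ') :
      Run (.instr i) σ σ' 1 (max σ.space σ'.space)
  | seq {p q : Program} {σ σ' σ'' : State} {n n' b b' : ℕ}
      (h : Run p σ σ' n b) (h' : Run q σ' σ'' n' b') :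
      Run (.seq p q) σ σ'' (n + n') (max b b')
  | cond_true {c : Cmp} {r₁ r₂ : ℕ} {p q : Program} {σ σ' : State} {n b : ℕ}
      (hc : c.Holds (σ.reg r₁) (σ.reg r₂)) (h : Run p σ σ' n b) :
      Run (.cond c r₁ r₂ p q) σ σ' (n + 1) b
  | cond_false {c : Cmp} {r₁ r₂ : ℕ} {p q : Program} {σ σ' : State} {n b : ℕ}
      (hc : ¬ c.Holds (σ.reg r₁) (σ.reg r₂)) (h : Run q σ σ' n b) :
      Run (.cond c r₁ r₂ p q) σ σ' (n + 1) b
  | loop_true {c : Cmp} {r₁ r₂ : ℕ} {p : Program} {σ σ' σ'' : State} {n n' b b' : ℕ}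
      (hc : c.Holds (σ.reg r₁) (σ.reg r₂)) (h : Run p σ σ' n b)
      (h' : Run (.loop c r₁ r₂ p) σ' σ'' n' b') :
      Run (.loop c r₁ r₂ p) σ σ'' (n + n' + 1) (max b b')
  | loop_false {c : Cmp} {r₁ r₂ : ℕ} {p : Program} {σ : State}
      (hc : ¬ c.Holds (σ.reg r₁) (σ.reg r₂)) :
      Run (.loop c r₁ r₂ p) σ σ 1 σ.space

end ArithRAM

/-! The lifting has a closed form. On finitely many states, `d̂(μ, η)` is the maximum of `⋁_x ⋀_{y :
μ x ≤ η y} (μ x ∧ d x y)` and the same expression with `μ` and `η` exchanged (`liftDist_eq`). This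
covers `μ(S) ≠ η(S)` too: some infimum is then empty and equals 1. So the functional needs only
comparisons, minima and maxima of membership degrees and entries of `d`. As `[0,1]` is a chain, an
iteration from the zero matrix stays in the finite set `V` of 0, 1 and the degrees of the system.

For each transition out of a state `s` and each state `t`, the program computes the least lifted
distance to an equally labelled transition of `t` (`gap`) and raises the entries at `(s,t)` and
`(t,s)` to it, in place. The closed form makes sense for arbitrary matrices, so the matrix need not
be a pseudo-ultrametric on the way. Call a matrix closed if no such update changes it. The
behavioural distance is the least closed matrix (`closed_distMatrix`, `distMatrix_le_of_closed`). By
monotonicity the updates never exceed it, so a round without change has reached it. Any other round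
moves some entry up within `V`, and there are `N * N` entries and fewer than `len` values, where
`len` is the length of the input. Hence `N * N * len` rounds suffice (`exec_rounds`).

Arithmetic is applied only to addresses and counters, while degrees are just compared and copied, so
no number grows beyond the input and the polynomially bounded addresses. Time and space are tracked
together by the judgement `Exec`. The number of listed transitions is at most `size + numEmpty`,
since a transition with nonempty support counts in `size` and any other in `numEmpty`. -/

namespace ArithRAM

/-! ### Register and memory updates; what a program leaves unchanged -/

@[simp] theorem State.setReg_reg (σ : State) (r r' : ℕ) (q : ℚ) :
    (σ.setReg r q).reg r' = if r' = r then q else σ.reg r' := by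
  classical
  simp [State.setReg, Finsupp.update_apply]

@[simp] theorem State.setReg_mem (σ : State) (r : ℕ) (q : ℚ) : (σ.setReg r q).mem = σ.mem := rfl

@[simp] theorem State.setMem_reg (σ : State) (k : ℕ) (q : ℚ) : (σ.setMem k q).reg = σ.reg := rfl

@[simp] theorem State.setMem_mem (σ : State) (k k' : ℕ) (q : ℚ) :
    (σ.setMem k q).mem k' = if k' = k then q else σ.mem k' := by
  classical
  simp [State.setMem, Finsupp.update_apply]

theorem State.setReg_setReg (σ : State) (r : ℕ) (q q' : ℚ) :
    (σ.setReg r q).setReg r q' = σ.setReg r q' := by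
  unfold State.setReg
  congr 1
  ext r'
  classical
  simp only [Finsupp.update_apply]
  split_ifs <;> rfl

/-- The instruction writes no register below `c`. -/
def Instr.writesFrom (c : ℕ) : Instr → Bool
  | .skip => true
  | .const r _ => c.ble r
  | .move r _ => c.ble r
  | .arith _ r _ _ => c.ble r
  | .load r _ => c.ble r
  | .store _ _ => true

/-- The instruction does not write to the memory. -/
def Instr.noStore : Instr → Bool
  | .store _ _ => false
  | _ => true

/-- The program writes no register below `c`. -/
def Program.writesFrom (c : ℕ) : Program → Bool
  | .instr i => i.writesFrom c
  | .seq p q => p.writesFrom c && q.writesFrom c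
  | .cond _ _ _ p q => p.writesFrom c && q.writesFrom c
  | .loop _ _ _ p => p.writesFrom c

/-- The program does not write to the memory. -/
def Program.noStore : Program → Bool
  | .instr i => i.noStore
  | .seq p q => p.noStore && q.noStore
  | .cond _ _ _ p q => p.noStore && q.noStore
  | .loop _ _ _ p => p.noStore

theorem Step.reg_eq {i : Instr} {σ σ' : State} (h : Step i σ σ') {c : ℕ}
    (hc : i.writesFrom c = true) {r : ℕ} (hr : r < c) : σ'.reg r = σ.reg r := by
  cases h <;> simp [Instr.writesFrom] at hc ⊢ <;> intros <;> omega

theorem Step.mem_eq {i : Instr} {σ σ' : State} (h : Step i σ σ')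
    (hc : i.noStore = true) : σ'.mem = σ.mem := by
  cases h <;> simp_all [Instr.noStore]

/-- Inner loops use higher registers than outer ones, and `writesFrom` is decided by evaluation. So
counters and parameters of outer loops survive an inner program without being part of its invariant.
-/
theorem Run.reg_eq {p : Program} {σ σ' : State} {n b : ℕ} (h : Run p σ σ' n b) {c : ℕ}
    (hc : p.writesFrom c = true) {r : ℕ} (hr : r < c) : σ'.reg r = σ.reg r := by
  induction h with
  | instr h => exact h.reg_eq hc hr
  | seq _ _ ih ih' =>
    simp only [Program.writesFrom, Bool.and_eq_true] at hc
    rw [ih' hc.2, ih hc.1]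
  | cond_true _ _ ih =>
    simp only [Program.writesFrom, Bool.and_eq_true] at hc
    exact ih hc.1
  | cond_false _ _ ih =>
    simp only [Program.writesFrom, Bool.and_eq_true] at hc
    exact ih hc.2
  | loop_true _ _ _ ih ih' => rw [ih' hc, ih hc]
  | loop_false _ => rfl

theorem Run.mem_eq {p : Program} {σ σ' : State} {n b : ℕ} (h : Run p σ σ' n b)
    (hc : p.noStore = true) : σ'.mem = σ.mem := by
  induction h with
  | instr h => exact h.mem_eq hc
  | seq _ _ ih ih' =>
    simp only [Program.noStore, Bool.and_eq_true] at hc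
    rw [ih' hc.2, ih hc.1]
  | cond_true _ _ ih =>
    simp only [Program.noStore, Bool.and_eq_true] at hc
    exact ih hc.1
  | cond_false _ _ ih =>
    simp only [Program.noStore, Bool.and_eq_true] at hc
    exact ih hc.2
  | loop_true _ _ _ ih ih' => rw [ih' hc, ih hc]
  | loop_false _ => rfl

/-! ### Bit lengths and the space of bounded states -/

theorem size_le_self (m : ℕ) : m.size ≤ m := Nat.size_le.2 Nat.lt_two_pow_self

theorem ratBits_natCast_le (m : ℕ) : ratBits (m : ℚ) ≤ m + 1 := by
  have h1 := size_le_self m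
  have h2 : Nat.size 1 = 1 := by decide
  simp only [ratBits, Rat.num_natCast, Int.natAbs_natCast, Rat.den_natCast, h2]
  omega

/-- Only registers below `40` and memory cells below `K` are in use, and all contents have at most
`B` bits. -/
structure State.Bounded (K B : ℕ) (σ : State) : Prop where
  reg_lt : ∀ r, σ.reg r ≠ 0 → r < 40
  mem_lt : ∀ k, σ.mem k ≠ 0 → k < K
  reg_bits : ∀ r, ratBits (σ.reg r) ≤ B
  mem_bits : ∀ k, ratBits (σ.mem k) ≤ B

/-- The space of a bounded state. -/
def spaceBound (K B : ℕ) : ℕ := 40 * (40 + B) + K * (K + B)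

theorem sum_support_le (f : ℕ →₀ ℚ) (K B : ℕ) (h1 : ∀ k, f k ≠ 0 → k < K)
    (h2 : ∀ k, ratBits (f k) ≤ B) :
    ∑ k ∈ f.support, (k.size + ratBits (f k)) ≤ K * (K + B) := by
  have hs : f.support ⊆ Finset.range K := fun k hk =>
    Finset.mem_range.2 (h1 k (Finsupp.mem_support_iff.1 hk))
  calc ∑ k ∈ f.support, (k.size + ratBits (f k))
      ≤ ∑ k ∈ Finset.range K, (k.size + ratBits (f k)) :=
        Finset.sum_le_sum_of_subset hs
    _ ≤ ∑ _k ∈ Finset.range K, (K + B) := Finset.sum_le_sum fun k hk =>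
        add_le_add ((size_le_self k).trans (Finset.mem_range.1 hk).le) (h2 k)
    _ = K * (K + B) := by simp

theorem State.Bounded.space_le {K B : ℕ} {σ : State} (h : σ.Bounded K B) :
    σ.space ≤ spaceBound K B :=
  add_le_add (sum_support_le _ _ _ h.reg_lt h.reg_bits) (sum_support_le _ _ _ h.mem_lt h.mem_bits)

theorem State.Bounded.setReg {K B : ℕ} {σ : State} (h : σ.Bounded K B) {r : ℕ} {q : ℚ}
    (hr : r < 40) (hq : ratBits q ≤ B) : (σ.setReg r q).Bounded K B where
  reg_lt r' hr' := by
    rw [State.setReg_reg] at hr'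
    split_ifs at hr' with h'
    · omega
    · exact h.reg_lt r' hr'
  mem_lt := h.mem_lt
  reg_bits r' := by
    rw [State.setReg_reg]
    split_ifs
    · exact hq
    · exact h.reg_bits r'
  mem_bits := h.mem_bits

theorem State.Bounded.setMem {K B : ℕ} {σ : State} (h : σ.Bounded K B) {k : ℕ} {q : ℚ}
    (hk : k < K) (hq : ratBits q ≤ B) : (σ.setMem k q).Bounded K B where
  reg_lt := h.reg_lt
  mem_lt k' hk' := by
    rw [State.setMem_mem] at hk'
    split_ifs at hk' with h'
    · omega
    · exact h.mem_lt k' hk'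
  reg_bits := h.reg_bits
  mem_bits k' := by
    rw [State.setMem_mem]
    split_ifs
    · exact hq
    · exact h.mem_bits k'

/-! ### A program logic with time and space bounds -/

/-- Started in the bounded state `σ`, the program halts within `n` steps in a bounded state that
satisfies `Q`, and all states on the way are bounded. -/
def Exec (K B : ℕ) (p : Program) (n : ℕ) (σ : State) (Q : State → Prop) : Prop :=
  σ.Bounded K B → ∃ σ' m b, Run p σ σ' m b ∧ m ≤ n ∧ b ≤ spaceBound K B ∧ σ'.Bounded K B ∧ Q σ'

namespace Exec

variable {K B : ℕ}

/-- Adds to a specification what the program text alone guarantees. The flag `s` switches off the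
memory clause for programs that store. -/
theorem frame {p : Program} {n : ℕ} {σ : State} {Q : State → Prop} (c : ℕ) (s : Bool)
    (hc : p.writesFrom c = true) (hs : s = true → p.noStore = true)
    (h : Exec K B p n σ Q) :
    Exec K B p n σ fun σ' =>
      (∀ r < c, σ'.reg r = σ.reg r) ∧ (s = true → σ'.mem = σ.mem) ∧ Q σ' := fun hσ => by
  obtain ⟨σ', m, b, h1, h2, h3, h4, h5⟩ := h hσ
  exact ⟨σ', m, b, h1, h2, h3, h4, fun r hr => h1.reg_eq hc hr, fun h => h1.mem_eq (hs h), h5⟩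

theorem mono {p : Program} {n n' : ℕ} {σ : State} {Q Q' : State → Prop}
    (h : Exec K B p n σ Q) (hn : n ≤ n') (hQ : ∀ σ', Q σ' → Q' σ') : Exec K B p n' σ Q' :=
  fun hσ => by
  obtain ⟨σ', m, b, h1, h2, h3, h4, h5⟩ := h hσ
  exact ⟨σ', m, b, h1, h2.trans hn, h3, h4, hQ _ h5⟩

theorem seq {p q : Program} {n n' : ℕ} {σ : State} {Q : State → Prop}
    (h : Exec K B p n σ fun σ' => Exec K B q n' σ' Q) : Exec K B (.seq p q) (n + n') σ Q :=
  fun hσ => by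
  obtain ⟨σ', m, b, h1, h2, h3, h4, h5⟩ := h hσ
  obtain ⟨σ'', m', b', h1', h2', h3', h4', h5'⟩ := h5 h4
  exact ⟨σ'', _, _, h1.seq h1', add_le_add h2 h2', max_le h3 h3', h4', h5'⟩

theorem cond {c : Cmp} {r₁ r₂ : ℕ} {p q : Program} {n : ℕ} {σ : State} {Q : State → Prop}
    (hp : c.Holds (σ.reg r₁) (σ.reg r₂) → Exec K B p n σ Q)
    (hq : ¬ c.Holds (σ.reg r₁) (σ.reg r₂) → Exec K B q n σ Q) :
    Exec K B (.cond c r₁ r₂ p q) (n + 1) σ Q := fun hσ => by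
  by_cases hc : c.Holds (σ.reg r₁) (σ.reg r₂)
  · obtain ⟨σ', m, b, h1, h2, h3, h4, h5⟩ := hp hc hσ
    exact ⟨σ', _, _, .cond_true hc h1, by omega, h3, h4, h5⟩
  · obtain ⟨σ', m, b, h1, h2, h3, h4, h5⟩ := hq hc hσ
    exact ⟨σ', _, _, .cond_false hc h1, by omega, h3, h4, h5⟩

theorem of_step {i : Instr} {σ σ' : State} {Q : State → Prop} (h : Step i σ σ')
    (hb : σ.Bounded K B → σ'.Bounded K B) (hQ : Q σ') : Exec K B (.instr i) 1 σ Q := fun hσ =>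
  ⟨σ', 1, _, .instr h, le_rfl, max_le hσ.space_le (hb hσ).space_le, hb hσ, hQ⟩

theorem skip {n : ℕ} {σ : State} {Q : State → Prop} (hn : 1 ≤ n) (hQ : Q σ) :
    Exec K B (.instr .skip) n σ Q :=
  (of_step (.skip σ) id hQ).mono hn fun _ => id

theorem const {σ : State} {Q : State → Prop} {r : ℕ} (m : ℕ) (hr : r < 40)
    (hB : m + 1 ≤ B) (hQ : Q (σ.setReg r m)) : Exec K B (.instr (.const r m)) 1 σ Q :=
  of_step (.const σ r m) (fun h => h.setReg hr ((ratBits_natCast_le m).trans hB)) hQ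

theorem move {σ : State} {Q : State → Prop} {r r₁ : ℕ} (hr : r < 40)
    (hQ : Q (σ.setReg r (σ.reg r₁))) : Exec K B (.instr (.move r r₁)) 1 σ Q :=
  of_step (.move σ r r₁) (fun h => h.setReg hr (h.reg_bits r₁)) hQ

/-- Natural operands are enough, as only addresses and counters are ever computed. The value of a
natural number is a generous but sufficient bound for its bits. -/
theorem add {σ : State} {Q : State → Prop} {r r₁ r₂ : ℕ} (m₁ m₂ : ℕ) (hr : r < 40)
    (h₁ : σ.reg r₁ = m₁) (h₂ : σ.reg r₂ = m₂) (hB : m₁ + m₂ + 1 ≤ B)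
    (hQ : Q (σ.setReg r (m₁ + m₂ : ℕ))) : Exec K B (.instr (.arith .add r r₁ r₂)) 1 σ Q := by
  have he : Op.add.eval (σ.reg r₁) (σ.reg r₂) = (m₁ + m₂ : ℕ) := by simp [Op.eval, h₁, h₂]
  have hs := Step.arith σ .add r r₁ r₂ (by simp)
  rw [he] at hs
  exact of_step hs (fun h => h.setReg hr ((ratBits_natCast_le _).trans hB)) hQ

theorem mul {σ : State} {Q : State → Prop} {r r₁ r₂ : ℕ} (m₁ m₂ : ℕ) (hr : r < 40)
    (h₁ : σ.reg r₁ = m₁) (h₂ : σ.reg r₂ = m₂) (hB : m₁ * m₂ + 1 ≤ B)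
    (hQ : Q (σ.setReg r (m₁ * m₂ : ℕ))) : Exec K B (.instr (.arith .mul r r₁ r₂)) 1 σ Q := by
  have he : Op.mul.eval (σ.reg r₁) (σ.reg r₂) = (m₁ * m₂ : ℕ) := by simp [Op.eval, h₁, h₂]
  have hs := Step.arith σ .mul r r₁ r₂ (by simp)
  rw [he] at hs
  exact of_step hs (fun h => h.setReg hr ((ratBits_natCast_le _).trans hB)) hQ

theorem load {σ : State} {Q : State → Prop} {r a : ℕ} (k : ℕ) (hr : r < 40)
    (ha : σ.reg a = k) (hQ : Q (σ.setReg r (σ.mem k))) : Exec K B (.instr (.load r a)) 1 σ Q :=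
  of_step (.load σ r a k ha) (fun h => h.setReg hr (h.mem_bits k)) hQ

theorem store {σ : State} {Q : State → Prop} {r a : ℕ} (k : ℕ) (hk : k < K)
    (ha : σ.reg a = k) (hQ : Q (σ.setMem k (σ.reg r))) : Exec K B (.instr (.store a r)) 1 σ Q :=
  of_step (.store σ a r k ha) (fun h => h.setMem hk (h.reg_bits r)) hQ

end Exec

/-! ### Array access, minimum, maximum and counting loops -/

/-- `r := (register i) * (register w) + (register b) + (register o)` -/
def Program.address (r b i w o : ℕ) : Program :=
  .seq (.instr (.arith .mul r i w)) (.seq (.instr (.arith .add r r b)) (.instr (.arith .add r r o)))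

/-- `r := mem[i * w + b + o]` -/
def Program.fetch (r b i w o : ℕ) : Program :=
  .seq (.address r b i w o) (.instr (.load r r))

/-- `mem[i * w + b + o] := r`, with the address computed in register `s`. -/
def Program.put (s b i w o r : ℕ) : Program :=
  .seq (.address s b i w o) (.instr (.store s r))

/-- `if r₂ < r₁ then r₁ := r₂` -/
def Program.minWith (r₁ r₂ : ℕ) : Program :=
  .cond .lt r₂ r₁ (.instr (.move r₁ r₂)) (.instr .skip)

/-- `if r₁ < r₂ then r₁ := r₂` -/
def Program.maxWith (r₁ r₂ : ℕ) : Program :=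
  .cond .lt r₁ r₂ (.instr (.move r₁ r₂)) (.instr .skip)

/-- `for i = 0, …, n - 1 do p`, provided that register `1` holds `1`. -/
def Program.forTo (i n : ℕ) (p : Program) : Program :=
  .seq (.instr (.const i (0 : ℕ))) (.loop .lt i n (.seq p (.instr (.arith .add i i 1))))

namespace Exec

variable {K B : ℕ}

theorem address {σ : State} {Q : State → Prop} {r b i w o : ℕ} (mb mi mw mo : ℕ) (hr : r < 40)
    (hrb : b ≠ r) (hro : o ≠ r)
    (hb : σ.reg b = mb) (hi : σ.reg i = mi) (hw : σ.reg w = mw) (ho : σ.reg o = mo)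
    (hB : mi * mw + mb + mo + 1 ≤ B) (hQ : Q (σ.setReg r (mi * mw + mb + mo : ℕ))) :
    Exec K B (.address r b i w o) 3 σ Q := by
  refine seq (n := 1) (n' := 2) (mul mi mw hr hi hw (by omega) ?_)
  refine seq (n := 1) (n' := 1) (add (mi * mw) mb hr (by simp) (by simp [hrb, hb]) (by omega) ?_)
  refine add (mi * mw + mb) mo hr (by simp) (by simp [hro, ho]) (by omega) ?_
  rwa [State.setReg_setReg, State.setReg_setReg]

theorem fetch {σ : State} {Q : State → Prop} {r b i w o : ℕ} (mb mi mw mo : ℕ) (hr : r < 40)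
    (hrb : b ≠ r) (hro : o ≠ r)
    (hb : σ.reg b = mb) (hi : σ.reg i = mi) (hw : σ.reg w = mw) (ho : σ.reg o = mo)
    (hB : mi * mw + mb + mo + 1 ≤ B) (hQ : Q (σ.setReg r (σ.mem (mi * mw + mb + mo)))) :
    Exec K B (.fetch r b i w o) 4 σ Q := by
  refine seq (n := 3) (n' := 1) (address mb mi mw mo hr hrb hro hb hi hw ho hB ?_)
  refine load (mi * mw + mb + mo) hr (by simp) ?_
  rwa [State.setReg_setReg]

theorem put {σ : State} {Q : State → Prop} {s b i w o r : ℕ} (mb mi mw mo : ℕ) (hs : s < 40)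
    (hsb : b ≠ s) (hso : o ≠ s) (hsr : r ≠ s)
    (hb : σ.reg b = mb) (hi : σ.reg i = mi) (hw : σ.reg w = mw) (ho : σ.reg o = mo)
    (hB : mi * mw + mb + mo + 1 ≤ B) (hK : mi * mw + mb + mo < K)
    (hQ : Q ((σ.setReg s (mi * mw + mb + mo : ℕ)).setMem (mi * mw + mb + mo) (σ.reg r))) :
    Exec K B (.put s b i w o r) 4 σ Q := by
  refine seq (n := 3) (n' := 1) (address mb mi mw mo hs hsb hso hb hi hw ho hB ?_)
  refine store (mi * mw + mb + mo) hK (by simp) ?_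
  simpa [hsr] using hQ

/-- The invariant is required after the counter has been set to `k + 1`, because the loop itself
performs the increment. The bound counts the initialisation and the last, failing test once, and one
test and one increment per iteration. -/
theorem forTo {i n t m : ℕ} {body : Program} {σ : State} (Inv : ℕ → State → Prop)
    (hi : i < 40) (hni : n < i) (h1i : 1 < i) (hm : σ.reg n = m) (h1 : σ.reg 1 = 1)
    (hB : m + 1 ≤ B) (hw : body.writesFrom (i + 1) = true)
    (h0 : Inv 0 (σ.setReg i 0))
    (hstep : ∀ k < m, ∀ σ' : State, Inv k σ' → σ'.reg i = k → (∀ r < i, σ'.reg r = σ.reg r) →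
      (body.noStore = true → σ'.mem = σ.mem) →
      Exec K B body t σ' fun σ'' => Inv (k + 1) (σ''.setReg i (k + 1 : ℕ))) :
    Exec K B (.forTo i n body) (2 + m * (t + 2)) σ fun σ' =>
      (∀ r < i, σ'.reg r = σ.reg r) ∧ (body.noStore = true → σ'.mem = σ.mem) ∧ Inv m σ' := by
  -- Induction on the number `l` of iterations that remain.
  have key : ∀ l k, k + l = m → ∀ σ' : State, Inv k σ' → σ'.reg i = k →
      (∀ r < i, σ'.reg r = σ.reg r) → (body.noStore = true → σ'.mem = σ.mem) →
      Exec K B (.loop .lt i n (.seq body (.instr (.arith .add i i 1)))) (1 + l * (t + 2)) σ'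
        fun σ' => (∀ r < i, σ'.reg r = σ.reg r) ∧ (body.noStore = true → σ'.mem = σ.mem) ∧
          Inv m σ' := by
    intro l
    induction l with
    | zero =>
      intro k hk σ' hInv hk' hr hmem hσ'
      refine ⟨σ', 1, _, .loop_false ?_, by omega, hσ'.space_le, hσ', hr, hmem, ?_⟩
      · simp only [Cmp.Holds, hk', hr n hni, hm, Nat.cast_lt]
        omega
      · rwa [← hk]
    | succ l ih =>
      intro k hk σ' hInv hk' hr hmem hσ'
      have hb : Exec K B (.seq body (.instr (.arith .add i i 1))) (t + 1) σ' fun σ'' =>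
          Inv (k + 1) σ'' ∧ σ''.reg i = (k + 1 : ℕ) ∧ (∀ r < i, σ''.reg r = σ.reg r) ∧
            (body.noStore = true → σ''.mem = σ.mem) := by
        refine seq (((hstep k (by omega) σ' hInv hk' hr hmem).frame (i + 1) body.noStore hw
          id).mono le_rfl ?_)
        rintro σ'' ⟨hr', hmem', hInv'⟩
        refine add k 1 hi ((hr' i (by omega)).trans hk')
          ((hr' 1 (by omega)).trans ((hr 1 h1i).trans (by simpa using h1))) (by omega)
          ⟨hInv', by simp, fun r hri => ?_, fun hs => ?_⟩
        · rw [State.setReg_reg, if_neg (by omega), hr' r (by omega), hr r hri]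
        · rw [State.setReg_mem, hmem' hs, hmem hs]
      obtain ⟨σ₁, n₁, b₁, r1, r2, r3, r4, r5, r6, r7, r8⟩ := hb hσ'
      obtain ⟨σ₂, n₂, b₂, s1, s2, s3, s4, s5⟩ := ih (k + 1) (by omega) σ₁ r5 r6 r7 r8 r4
      refine ⟨σ₂, _, _, .loop_true ?_ r1 s1, ?_, max_le r3 s3, s4, s5⟩
      · simp only [Cmp.Holds, hk', hr n hni, hm, Nat.cast_lt]
        omega
      · rw [Nat.succ_mul]
        omega
  refine (seq (n := 1) (n' := 1 + m * (t + 2)) (const 0 hi (by omega) ?_)).mono (by omega)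
    fun _ => id
  refine key m 0 (by omega) _ (by simpa using h0) (by simp) (fun r hr => ?_) (fun _ => rfl)
  rw [State.setReg_reg, if_neg (by omega)]

end Exec

end ArithRAM

open ArithRAM in
theorem ArithRAM.State.setReg_self (σ : State) (r : ℕ) : σ.setReg r (σ.reg r) = σ := by
  cases σ
  simp [State.setReg]

/-! ### Rational representatives of elements of the unit interval -/

/-- The rational number `q` is the number `v` of the unit interval. -/
def UnitRep (q : ℚ) (v : unitInterval) : Prop := (q : ℝ) = (v : ℝ)

theorem UnitRep.le_iff {q q' : ℚ} {v v' : unitInterval} (h : UnitRep q v) (h' : UnitRep q' v') :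
    q ≤ q' ↔ v ≤ v' := by
  rw [← Subtype.coe_le_coe, ← h, ← h', Rat.cast_le]

theorem UnitRep.lt_iff {q q' : ℚ} {v v' : unitInterval} (h : UnitRep q v) (h' : UnitRep q' v') :
    q < q' ↔ v < v' := by
  rw [← Subtype.coe_lt_coe, ← h, ← h', Rat.cast_lt]

theorem unitRep_zero : UnitRep 0 ⊥ := by
  change ((0 : ℚ) : ℝ) = 0
  simp

theorem unitRep_one : UnitRep 1 ⊤ := by
  change ((1 : ℚ) : ℝ) = 1
  simp

namespace ArithRAM.Exec

variable {K B : ℕ}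

theorem minWith {σ : State} {Q : State → Prop} {r₁ r₂ : ℕ} {u v : unitInterval} (hr : r₁ < 40)
    (h₁ : UnitRep (σ.reg r₁) u) (h₂ : UnitRep (σ.reg r₂) v)
    (hQ : ∀ q, UnitRep q (u ⊓ v) → Q (σ.setReg r₁ q)) : Exec K B (.minWith r₁ r₂) 2 σ Q := by
  refine cond (n := 1) (fun h => move hr (hQ _ ?_)) fun h => skip le_rfl ?_
  · rwa [inf_eq_right.2 ((h₂.lt_iff h₁).1 h).le]
  -- Without a move the state is its own update by the old contents, which already are the minimum.
  · have := hQ (σ.reg r₁) (by rwa [inf_eq_left.2 (not_lt.1 ((h₂.lt_iff h₁).not.1 h))])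
    rwa [State.setReg_self] at this

theorem maxWith {σ : State} {Q : State → Prop} {r₁ r₂ : ℕ} {u v : unitInterval} (hr : r₁ < 40)
    (h₁ : UnitRep (σ.reg r₁) u) (h₂ : UnitRep (σ.reg r₂) v)
    (hQ : ∀ q, UnitRep q (u ⊔ v) → Q (σ.setReg r₁ q)) : Exec K B (.maxWith r₁ r₂) 2 σ Q := by
  refine cond (n := 1) (fun h => move hr (hQ _ ?_)) fun h => skip le_rfl ?_
  · rwa [sup_eq_right.2 ((h₁.lt_iff h₂).1 h).le]
  · have := hQ (σ.reg r₁) (by rwa [sup_eq_left.2 (not_lt.1 ((h₁.lt_iff h₂).not.1 h))])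
    rwa [State.setReg_self] at this

end ArithRAM.Exec

/-! ### Transition tables, their gaps and their layout in memory -/

/-- One half of the closed formula for the lifting, on fuzzy sets on `{0, …, N - 1}`. -/
noncomputable def halfDist (N : ℕ) (D : ℕ → ℕ → unitInterval) (μ η : ℕ → unitInterval) : unitInterval :=
  (Finset.range N).sup fun x => (Finset.range N).inf fun y => if μ x ≤ η y then μ x ⊓ D x y else ⊤

/-- `D` with the entry at `(i, k)` raised to at least `g`. -/
noncomputable def bump (D : ℕ → ℕ → unitInterval) (i k : ℕ) (g : unitInterval) : ℕ → ℕ → unitInterval :=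
  fun p q => if p = i ∧ q = k then D p q ⊔ g else D p q

/-- A list of `T` transitions on the states `0, …, N - 1`, and two states. -/
structure TransTable where
  N : ℕ
  T : ℕ
  src : ℕ → ℕ
  lab : ℕ → ℕ
  mu : ℕ → ℕ → unitInterval
  fst : ℕ
  snd : ℕ
  src_lt : ∀ j < T, src j < N
  fst_lt : fst < N
  snd_lt : snd < N

namespace TransTable

open ArithRAM

variable (I : TransTable)

/-- The closed formula for the lifting, applied to the targets of two transitions. -/
noncomputable def hat (D : ℕ → ℕ → unitInterval) (j j' : ℕ) : unitInterval :=
  halfDist I.N D (I.mu j) (I.mu j') ⊔ halfDist I.N D (I.mu j') (I.mu j)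

/-- The least lifted distance from the target of transition `j` to the target of a transition of
state `k` with the same label. -/
noncomputable def gap (D : ℕ → ℕ → unitInterval) (j k : ℕ) : unitInterval :=
  (Finset.range I.T).inf fun j' =>
    if I.src j' = k then (if I.lab j' = I.lab j then I.hat D j j' else ⊤) else ⊤

/-- The length of the input word. -/
def len : ℕ := 4 + I.T * (I.N + 2)

/-- The registers that hold the parameters. -/
structure Env (reg : ℕ → ℚ) : Prop where
  r0 : reg 0 = I.len
  r1 : reg 1 = (1 : ℕ)
  r2 : reg 2 = I.N
  r3 : reg 3 = I.T
  r4 : reg 4 = (I.N + 2 : ℕ)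
  r5 : reg 5 = (0 : ℕ)
  r6 : reg 6 = (4 : ℕ)
  r7 : reg 7 = (5 : ℕ)
  r8 : reg 8 = (6 : ℕ)

/-- The memory cells that hold the input. -/
structure Stored (mem : ℕ → ℚ) : Prop where
  states : mem 0 = I.N
  transitions : mem 1 = I.T
  fst : mem 2 = I.fst
  snd : mem 3 = I.snd
  -- The summand `0` is the contents of the offset register `5` in `Program.fetch`.
  src : ∀ j < I.T, mem (j * (I.N + 2) + 4 + 0) = I.src j
  lab : ∀ j < I.T, mem (j * (I.N + 2) + 5 + 0) = I.lab j
  mu : ∀ j < I.T, ∀ x < I.N, UnitRep (mem (j * (I.N + 2) + 6 + x)) (I.mu j x)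

/-- The memory cells that hold the matrix `D`. -/
def HoldsMatrix (D : ℕ → ℕ → unitInterval) (mem : ℕ → ℚ) : Prop :=
  ∀ p < I.N, ∀ q < I.N, UnitRep (mem (p * I.N + I.len + q)) (D p q)

variable {I}

theorem Env.congr {f g : ℕ → ℚ} (h : I.Env f) {c : ℕ} (hc : 9 ≤ c) (hfg : ∀ r < c, g r = f r) :
    I.Env g := by
  cases h
  constructor <;> rw [hfg _ (by omega)] <;> assumption

theorem Env.setReg {σ : State} (h : I.Env σ.reg) {r : ℕ} (hr : 9 ≤ r) (q : ℚ) :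
    I.Env (σ.setReg r q).reg :=
  h.congr hr fun r' hr' => by rw [State.setReg_reg, if_neg (by omega)]

/-- After four header cells each transition has a block of `N + 2` cells. Relative to `j * (N + 2)`,
its source is at 4, its label at 5 and its degrees start at 6. -/
theorem trans_address_lt {j x : ℕ} (hj : j < I.T) (hx : x < I.N) :
    j * (I.N + 2) + 6 + x < I.len := by
  have := Nat.mul_le_mul_right (I.N + 2) (Nat.succ_le_of_lt hj)
  rw [Nat.succ_mul] at this
  unfold len
  omega

theorem src_address_lt {j : ℕ} (hj : j < I.T) : j * (I.N + 2) + 5 < I.len := by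
  have := Nat.mul_le_mul_right (I.N + 2) (Nat.succ_le_of_lt hj)
  rw [Nat.succ_mul] at this
  unfold len
  omega

theorem matrix_address_lt {p q : ℕ} (hp : p < I.N) (hq : q < I.N) :
    p * I.N + I.len + q < I.len + I.N * I.N := by
  have := Nat.mul_le_mul_right I.N (Nat.succ_le_of_lt hp)
  rw [Nat.succ_mul] at this
  omega

/-- Quotient and remainder modulo `N` recover row and column. Hence a write changes one matrix entry
only. -/
theorem matrix_address_inj {p q p' q' : ℕ} (hq : q < I.N) (hq' : q' < I.N)
    (h : p * I.N + I.len + q = p' * I.N + I.len + q') : p = p' ∧ q = q' := by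
  have hN : 0 < I.N := by omega
  have h' : q + I.N * p = q' + I.N * p' := by rw [Nat.mul_comm I.N, Nat.mul_comm I.N]; omega
  have h1 := congrArg (· / I.N) h'
  have h2 := congrArg (· % I.N) h'
  simp only [Nat.add_mul_div_left _ _ hN, Nat.div_eq_of_lt hq, Nat.div_eq_of_lt hq', zero_add,
    Nat.add_mul_mod_self_left, Nat.mod_eq_of_lt hq, Nat.mod_eq_of_lt hq'] at h1 h2
  exact ⟨h1, h2⟩

/-! ### The program and its running time -/

/-- Comparison of the membership degree in register `21` with the degrees of transition `j'`. -/
def innerBody (j' : ℕ) : Program :=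
  .seq (.fetch 24 8 j' 4 22)
    (.cond .le 21 24
      (.seq (.fetch 25 0 19 2 22) (.seq (.minWith 23 25) (.minWith 23 21))) (.instr .skip))

/-- Register 19 holds `x`, register 22 runs over `y`, register 23 holds the minimum over `y`,
starting from 1 as the empty infimum, and register 20 the maximum over `x`. -/
def halfBody (j j' : ℕ) : Program :=
  .seq (.fetch 21 8 j 4 19)
    (.seq (.instr (.const 23 (1 : ℕ))) (.seq (.forTo 22 2 (innerBody j')) (.maxWith 20 23)))

/-- Raises register `20` to at least the half distance of the transitions in registers `j`, `j'`. -/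
def halfProg (j j' : ℕ) : Program := .forTo 19 2 (halfBody j j')

/-- Computes in register `20` the distance of the transitions in registers `11` and `15`. -/
def hatProg : Program :=
  .seq (.instr (.const 20 (0 : ℕ))) (.seq (halfProg 11 15) (halfProg 15 11))

/-- A transition with another source or label leaves the minimum alone, which matches its value `⊤`
in `gap`. -/
def gapBody : Program :=
  .seq (.fetch 17 6 15 4 5)
    (.cond .eq 17 14
      (.seq (.fetch 18 7 15 4 5)
        (.cond .eq 18 13 (.seq hatProg (.minWith 16 20)) (.instr .skip)))
      (.instr .skip))

/-- Computes in register `16` the gap of the transition in register `11` and the state in register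
`14`. -/
def gapProg : Program := .seq (.instr (.const 16 (1 : ℕ))) (.forTo 15 3 gapBody)

/-- Raises the entry at the indices in registers `p` and `q` to at least register `16`. -/
def bumpProg (p q : ℕ) : Program :=
  .seq (.fetch 25 0 p 2 q) (.cond .lt 25 16 (.put 26 0 p 2 q 16) (.instr .skip))

/-- The gap is a term of the Hausdorff distance of the two states in either order, so both entries
are raised. -/
def stateBody : Program := .seq gapProg (.seq (bumpProg 12 14) (bumpProg 14 12))

def transBody : Program :=
  .seq (.fetch 12 6 11 4 5) (.seq (.fetch 13 7 11 4 5) (.forTo 14 2 stateBody))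

/-- One round of updates. -/
def roundProg : Program := .forTo 11 3 transBody

/-- Register 5 is never written: its initial 0 serves as a constant and as the address of `N`.
Register 9 receives the number of rounds. -/
def initProg : Program :=
  .seq (.instr (.const 1 (1 : ℕ))) <| .seq (.instr (.load 2 5)) <| .seq (.instr (.load 3 1)) <|
  .seq (.instr (.const 4 (2 : ℕ))) <| .seq (.instr (.arith .add 4 2 4)) <|
  .seq (.instr (.const 6 (4 : ℕ))) <| .seq (.instr (.const 7 (5 : ℕ))) <|
  .seq (.instr (.const 8 (6 : ℕ))) <| .seq (.instr (.arith .mul 9 2 2)) <|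
  .instr (.arith .mul 9 9 0)

def outputProg : Program :=
  .seq (.instr (.const 10 (2 : ℕ))) <| .seq (.instr (.load 10 10)) <|
  .seq (.instr (.const 11 (3 : ℕ))) <| .seq (.instr (.load 11 11)) <|
  .seq (.fetch 12 0 10 2 11) <| .instr (.move 0 12)

/-- The program that computes the behavioural distance. -/
def mainProg : Program := .seq initProg (.seq (.forTo 10 9 roundProg) outputProg)

/-- Time bounds for the parts of the program. -/
def halfTime (N : ℕ) : ℕ := 2 + N * ((4 + (1 + ((2 + N * (13 + 2)) + 2))) + 2)

/-- The bracketing repeats the nesting of the program, so that the times given by the rules of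
`Exec` unify with it. -/
def gapTime (N T : ℕ) : ℕ :=
  1 + (2 + T * ((4 + ((4 + (((1 + (halfTime N + halfTime N)) + 2) + 1)) + 1)) + 2))

def roundTime (N T : ℕ) : ℕ :=
  2 + T * ((4 + (4 + (2 + N * ((gapTime N T + (9 + 9)) + 2)))) + 2)

/-- The bounds on addresses and contents suffice for the table `I`. -/
def Fits (I : TransTable) (K B : ℕ) : Prop :=
  -- Input and matrix occupy `len + N * N` cells; the term `N * N * len` is there for the round
  -- counter, whose contents must fit as well.
  I.N * I.N * I.len + I.len + I.N * I.N + 10 ≤ K ∧ K + 2 ≤ B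

/-! ### Correctness of a single update -/

variable {K B : ℕ}

theorem exec_innerBody (hF : I.Fits K B) {σ : State} {D : ℕ → ℕ → unitInterval}
    (rj' : ℕ) {j' x y : ℕ} {m h : unitInterval} (hE : I.Env σ.reg)
    (hS : I.Stored σ.mem) (hD : I.HoldsMatrix D σ.mem) (hj' : j' < I.T) (hx : x < I.N) (hy : y < I.N)
    (ej' : σ.reg rj' = j') (ex : σ.reg 19 = x) (ey : σ.reg 22 = y)
    (em : UnitRep (σ.reg 21) m) (eh : UnitRep (σ.reg 23) h) :
    Exec K B (innerBody rj') 13 σ fun σ' =>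
      UnitRep (σ'.reg 23) (h ⊓ if m ≤ I.mu j' y then m ⊓ D x y else ⊤) := by
  obtain ⟨hK, hB⟩ := hF
  have ha := trans_address_lt (I := I) hj' hy
  have ha' := matrix_address_lt (I := I) hx hy
  refine .seq (n := 4) (n' := 9) (.fetch 6 j' (I.N + 2) y (by omega) (by omega) (by omega)
    hE.r8 ej' hE.r4 ey (by omega) ?_)
  have hmu := hS.mu j' hj' y hy
  refine .cond (n := 8) (fun hc => ?_) fun hc => .skip (by omega) ?_
  · simp only [Cmp.Holds, State.setReg_reg] at hc
    norm_num at hc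
    rw [if_pos ((em.le_iff hmu).1 hc)]
    refine .seq (n := 4) (n' := 4) (.fetch I.len x I.N y (by omega) (by omega) (by omega)
      (by simp [hE.r0]) (by simp [ex]) (by simp [hE.r2]) (by simp [ey]) (by omega) ?_)
    refine .seq (n := 2) (n' := 2) (.minWith (u := h) (v := D x y) (by omega) (by simpa using eh)
      (by simpa using hD x hx y hy) fun q hq => ?_)
    refine .minWith (u := h ⊓ D x y) (v := m) (by omega) (by simpa using hq) (by simpa using em)
      fun q hq => ?_
    rw [State.setReg_reg, if_pos rfl, inf_comm m, ← inf_assoc]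
    exact hq
  · simp only [Cmp.Holds, State.setReg_reg] at hc
    norm_num at hc
    rw [if_neg (fun h => not_le.2 hc ((em.le_iff hmu).2 h)), inf_top_eq]
    simpa using eh

theorem exec_halfBody (hF : I.Fits K B) {σ : State} {D : ℕ → ℕ → unitInterval}
    (rj rj' : ℕ) (hrj' : rj' < 19) {j j' x : ℕ} {a : unitInterval}
    (hE : I.Env σ.reg)
    (hS : I.Stored σ.mem) (hD : I.HoldsMatrix D σ.mem) (hj : j < I.T) (hj' : j' < I.T) (hx : x < I.N)
    (ej : σ.reg rj = j) (ej' : σ.reg rj' = j') (ex : σ.reg 19 = x) (ea : UnitRep (σ.reg 20) a) :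
    Exec K B (halfBody rj rj') (4 + (1 + ((2 + I.N * (13 + 2)) + 2))) σ fun σ' =>
      UnitRep (σ'.reg 20) (a ⊔ (Finset.range I.N).inf fun y =>
        if I.mu j x ≤ I.mu j' y then I.mu j x ⊓ D x y else ⊤) := by
  have hF' := hF
  obtain ⟨hK, hB⟩ := hF'
  have ha := trans_address_lt (I := I) hj hx
  have hN : I.N ≤ I.len := by
    have := Nat.mul_le_mul_right (I.N + 2) (show 1 ≤ I.T by omega)
    unfold len
    omega
  refine .seq (.fetch 6 j (I.N + 2) x (by omega) (by omega) (by omega)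
    hE.r8 ej hE.r4 ex (by omega) ?_)
  have hmu := hS.mu j hj x hx
  refine .seq (.const 1 (by omega) (by omega) ?_)
  refine .seq (.mono (.forTo (m := I.N)
    (fun k σ' => UnitRep (σ'.reg 23) ((Finset.range k).inf fun y =>
        if I.mu j x ≤ I.mu j' y then I.mu j x ⊓ D x y else ⊤))
    (by omega) (by omega) (by omega) (by simp [hE.r2]) (by simp [hE.r1]) (by omega) rfl ?_ ?_)
    le_rfl ?_)
  · simpa using unitRep_one
  · intro k hk σ' hInv hi hr hm
    refine .mono (exec_innerBody hF rj' (D := D) (j' := j') (x := x) (y := k) (m := I.mu j x)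
      ?_ ?_ ?_ hj' hx hk ?_ ?_ hi ?_ hInv) le_rfl fun σ'' h => ?_
    · exact ((hE.setReg (by omega) _).setReg (by omega) _).congr (by omega) hr
    · rw [hm rfl]; exact hS
    · rw [hm rfl]; exact hD
    · rw [hr _ (by omega)]; simp [ej', show rj' ≠ 21 by omega, show rj' ≠ 23 by omega]
    · rw [hr _ (by omega)]; simp [ex]
    · rw [hr _ (by omega)]; simpa using hmu
    · rw [Finset.range_add_one, Finset.inf_insert, inf_comm]; simpa using h
  · rintro σ' ⟨hr, hm, hI⟩
    refine .maxWith (by omega) (u := a) ?_ hI fun q hq => ?_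
    · rw [hr _ (by omega)]; simpa using ea
    · simpa using hq

theorem exec_halfProg (hF : I.Fits K B) {σ : State} {D : ℕ → ℕ → unitInterval}
    (rj rj' : ℕ) (hrj : rj < 19) (hrj' : rj' < 19) {j j' : ℕ} {a : unitInterval}
    (hE : I.Env σ.reg)
    (hS : I.Stored σ.mem) (hD : I.HoldsMatrix D σ.mem) (hj : j < I.T) (hj' : j' < I.T)
    (ej : σ.reg rj = j) (ej' : σ.reg rj' = j') (ea : UnitRep (σ.reg 20) a) :
    Exec K B (halfProg rj rj') (halfTime I.N) σ fun σ' =>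
      (∀ r < 19, σ'.reg r = σ.reg r) ∧ σ'.mem = σ.mem ∧
        UnitRep (σ'.reg 20) (a ⊔ halfDist I.N D (I.mu j) (I.mu j')) := by
  have hF' := hF
  obtain ⟨hK, hB⟩ := hF'
  have hN : I.N ≤ I.len := by
    have := Nat.mul_le_mul_right (I.N + 2) (show 1 ≤ I.T by omega)
    unfold len
    omega
  refine .mono (.forTo (m := I.N) (t := 4 + (1 + ((2 + I.N * (13 + 2)) + 2)))
    (fun k σ' => UnitRep (σ'.reg 20) (a ⊔ (Finset.range k).sup fun x => (Finset.range I.N).inf fun y =>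
        if I.mu j x ≤ I.mu j' y then I.mu j x ⊓ D x y else ⊤))
    (by omega) (by omega) (by omega) (by simp [hE.r2]) (by simp [hE.r1]) (by omega) rfl ?_ ?_)
    le_rfl ?_
  · simpa using ea
  · intro k hk σ' hInv hi hr hm
    refine .mono (exec_halfBody hF rj rj' hrj' (D := D) (j := j) (j' := j') (x := k)
      ?_ ?_ ?_ hj hj' hk ?_ ?_ hi hInv) le_rfl fun σ'' h => ?_
    · exact hE.congr (by omega) hr
    · rw [hm rfl]; exact hS
    · rw [hm rfl]; exact hD
    · rw [hr _ (by omega), ej]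
    · rw [hr _ (by omega), ej']
    · rw [Finset.range_add_one, Finset.sup_insert, sup_comm (_ : unitInterval)
        (Finset.sup _ _), ← sup_assoc]
      simpa using h
  · rintro σ' ⟨hr, hm, hI⟩
    exact ⟨hr, hm rfl, hI⟩

theorem exec_hatProg (hF : I.Fits K B) {σ : State} {D : ℕ → ℕ → unitInterval} {j j' : ℕ}
    (hE : I.Env σ.reg)
    (hS : I.Stored σ.mem) (hD : I.HoldsMatrix D σ.mem) (hj : j < I.T) (hj' : j' < I.T)
    (ej : σ.reg 11 = j) (ej' : σ.reg 15 = j') :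
    Exec K B hatProg (1 + (halfTime I.N + halfTime I.N)) σ fun σ' =>
      (∀ r < 19, σ'.reg r = σ.reg r) ∧ UnitRep (σ'.reg 20) (I.hat D j j') := by
  have hF' := hF
  obtain ⟨hK, hB⟩ := hF'
  refine .seq (.const 0 (by omega) (by omega) ?_)
  refine .seq (.mono (exec_halfProg hF 11 15 (by omega) (by omega) (a := ⊥)
    (hE.setReg (by omega) _) hS hD hj hj' (by simp [ej]) (by simp [ej'])
    (by simpa using unitRep_zero)) le_rfl ?_)
  rintro σ' ⟨hr, hm, hI⟩
  have hr' : ∀ r < 19, σ'.reg r = σ.reg r := fun r h => by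
    rw [hr r h, State.setReg_reg, if_neg (by omega)]
  refine .mono (exec_halfProg hF 15 11 (by omega) (by omega) (D := D)
    (hE.congr (by omega) hr') (hm ▸ hS) (hm ▸ hD) hj' hj
    ((hr' _ (by omega)).trans ej') ((hr' _ (by omega)).trans ej) hI) le_rfl ?_
  rintro σ'' ⟨hr'', hm', hI'⟩
  refine ⟨fun r h => (hr'' r h).trans (hr' r h), ?_⟩
  rwa [bot_sup_eq] at hI'

theorem exec_gapBody (hF : I.Fits K B) {σ : State} {D : ℕ → ℕ → unitInterval} {j j' k : ℕ}
    {g : unitInterval} (hE : I.Env σ.reg)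
    (hS : I.Stored σ.mem) (hD : I.HoldsMatrix D σ.mem) (hj : j < I.T) (hj' : j' < I.T)
    (ej : σ.reg 11 = j) (ej' : σ.reg 15 = j') (ea : σ.reg 13 = I.lab j) (ek : σ.reg 14 = k)
    (eg : UnitRep (σ.reg 16) g) :
    Exec K B gapBody (4 + ((4 + (((1 + (halfTime I.N + halfTime I.N)) + 2) + 1)) + 1)) σ fun σ' =>
      UnitRep (σ'.reg 16)
        (g ⊓ if I.src j' = k then (if I.lab j' = I.lab j then I.hat D j j' else ⊤) else ⊤) := by
  have hF' := hF
  obtain ⟨hK, hB⟩ := hF'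
  have ha := src_address_lt (I := I) hj'
  refine .seq (.fetch 4 j' (I.N + 2) 0 (by omega) (by omega) (by omega)
    hE.r6 ej' hE.r4 hE.r5 (by omega) ?_)
  rw [hS.src j' hj']
  refine .cond (fun hc => ?_) fun hc => .skip (by omega) ?_
  · have hc' : I.src j' = k := by simpa [Cmp.Holds, ek] using hc
    rw [if_pos hc']
    refine .seq (.fetch 5 j' (I.N + 2) 0 (by omega) (by omega) (by omega)
      (by simp [hE.r7]) (by simp [ej']) (by simp [hE.r4]) (by simp [hE.r5]) (by omega) ?_)
    rw [State.setReg_mem, hS.lab j' hj']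
    refine .cond (fun hc => ?_) fun hc => .skip (by omega) ?_
    · have hc' : I.lab j' = I.lab j := by simpa [Cmp.Holds, ea] using hc
      rw [if_pos hc']
      refine .seq (.mono (exec_hatProg hF (D := D) (j := j) (j' := j')
        ((hE.setReg (by omega) _).setReg (by omega) _) hS hD hj hj' (by simp [ej])
        (by simp [ej'])) le_rfl ?_)
      rintro σ' ⟨hr, hI⟩
      refine .minWith (u := g) (by omega) ?_ hI fun q hq => ?_
      · rw [hr _ (by omega)]; simpa using eg
      · simpa using hq
    · have hc' : I.lab j' ≠ I.lab j := by simpa [Cmp.Holds, ea] using hc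
      rw [if_neg hc', inf_top_eq]
      simpa using eg
  · have hc' : I.src j' ≠ k := by simpa [Cmp.Holds, ek] using hc
    rw [if_neg hc', inf_top_eq]
    simpa using eg

theorem exec_gapProg (hF : I.Fits K B) {σ : State} {D : ℕ → ℕ → unitInterval} {j k : ℕ}
    (hE : I.Env σ.reg)
    (hS : I.Stored σ.mem) (hD : I.HoldsMatrix D σ.mem) (hj : j < I.T)
    (ej : σ.reg 11 = j) (ea : σ.reg 13 = I.lab j) (ek : σ.reg 14 = k) :
    Exec K B gapProg (gapTime I.N I.T) σ fun σ' =>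
      (∀ r < 15, σ'.reg r = σ.reg r) ∧ σ'.mem = σ.mem ∧ UnitRep (σ'.reg 16) (I.gap D j k) := by
  have hF' := hF
  obtain ⟨hK, hB⟩ := hF'
  have hT : I.T ≤ I.len := by
    have := Nat.mul_le_mul_left I.T (show 1 ≤ I.N + 2 by omega)
    unfold len
    omega
  refine .seq (.const 1 (by omega) (by omega) ?_)
  refine .mono (.forTo (m := I.T)
    (t := 4 + ((4 + (((1 + (halfTime I.N + halfTime I.N)) + 2) + 1)) + 1))
    (fun n σ' => UnitRep (σ'.reg 16) ((Finset.range n).inf fun j' =>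
      if I.src j' = k then (if I.lab j' = I.lab j then I.hat D j j' else ⊤) else ⊤))
    (by omega) (by omega) (by omega) (by simp [hE.r3]) (by simp [hE.r1]) (by omega) rfl ?_ ?_)
    le_rfl ?_
  · simpa using unitRep_one
  · intro n hn σ' hInv hi hr hm
    have hr' : ∀ r < 15, σ'.reg r = σ.reg r := fun r h => by
      rw [hr r h, State.setReg_reg, if_neg (by omega)]
    refine .mono (exec_gapBody hF (D := D) (j := j) (j' := n) (k := k)
      ?_ ?_ ?_ hj hn ?_ hi ?_ ?_ hInv) le_rfl fun σ'' h => ?_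
    · exact hE.congr (by omega) hr'
    · rw [hm rfl]; exact hS
    · rw [hm rfl]; exact hD
    · rw [hr' _ (by omega), ej]
    · rw [hr' _ (by omega), ea]
    · rw [hr' _ (by omega), ek]
    · rw [Finset.range_add_one, Finset.inf_insert, inf_comm]
      simpa using h
  · rintro σ' ⟨hr, hm, hI⟩
    exact ⟨fun r h => by rw [hr r h, State.setReg_reg, if_neg (by omega)], hm rfl, hI⟩

theorem exec_bumpProg (hF : I.Fits K B) {σ : State} {D : ℕ → ℕ → unitInterval}
    (rp rq : ℕ) (hrp : rp < 25) (hrq : rq < 25) {p q : ℕ} {g : unitInterval}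
    (hE : I.Env σ.reg)
    (hS : I.Stored σ.mem) (hD : I.HoldsMatrix D σ.mem) (hp : p < I.N) (hq : q < I.N)
    (ep : σ.reg rp = p) (eq : σ.reg rq = q) (eg : UnitRep (σ.reg 16) g) :
    Exec K B (bumpProg rp rq) 9 σ fun σ' =>
      I.Stored σ'.mem ∧ I.HoldsMatrix (bump D p q g) σ'.mem := by
  obtain ⟨hK, hB⟩ := hF
  have ha := matrix_address_lt (I := I) hp hq
  refine .seq (n := 4) (n' := 5) (.fetch I.len p I.N q (by omega) (by omega) (by omega)
    hE.r0 ep hE.r2 eq (by omega) ?_)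
  have hpq := hD p hp q hq
  refine .cond (n := 4) (fun hc => ?_) fun hc => .skip (by omega) ?_
  · simp only [Cmp.Holds, State.setReg_reg] at hc
    norm_num at hc
    have hlt := (hpq.lt_iff eg).1 hc
    refine .put I.len p I.N q (by omega) (by omega) (by omega) (by omega)
      (by simp [hE.r0]) (by simp [ep, show rp ≠ 25 by omega]) (by simp [hE.r2])
      (by simp [eq, show rq ≠ 25 by omega]) (by omega) (by omega) ?_
    have hlen : 4 ≤ I.len := by unfold len; omega
    -- The matrix starts at address `len`, behind the input, which the write therefore leaves
    -- intact.
    have hout : ∀ k < I.len, ((((σ.setReg 25 (σ.mem (p * I.N + I.len + q))).setReg 26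
        (p * I.N + I.len + q : ℕ)).setMem (p * I.N + I.len + q)
        ((σ.setReg 25 (σ.mem (p * I.N + I.len + q))).reg 16)).mem k) = σ.mem k := fun k hk => by
      rw [State.setMem_mem, if_neg (by omega)]; rfl
    refine ⟨⟨(hout _ (by omega)).trans hS.states, (hout _ (by omega)).trans hS.transitions,
      (hout _ (by omega)).trans hS.fst, (hout _ (by omega)).trans hS.snd, fun j hj => ?_, fun j hj => ?_, fun j hj x hx => ?_⟩,
      fun p' hp' q' hq' => ?_⟩
    · rw [hout _ (by have := src_address_lt (I := I) hj; omega)]; exact hS.src j hj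
    · rw [hout _ (by have := src_address_lt (I := I) hj; omega)]; exact hS.lab j hj
    · rw [hout _ (trans_address_lt hj hx)]; exact hS.mu j hj x hx
    · rw [State.setMem_mem]
      unfold bump
      by_cases h : p' = p ∧ q' = q
      · rw [if_pos h, if_pos (by rw [h.1, h.2]), h.1, h.2, sup_eq_right.2 hlt.le]
        simpa using eg
      · rw [if_neg h, if_neg (fun h' => h (matrix_address_inj hq' hq h'))]
        exact hD p' hp' q' hq'
  · simp only [Cmp.Holds, State.setReg_reg] at hc
    norm_num at hc
    refine ⟨hS, fun p' hp' q' hq' => ?_⟩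
    unfold bump
    split_ifs with h
    · obtain ⟨rfl, rfl⟩ := h
      rw [sup_eq_left.2 ((eg.le_iff hpq).1 hc)]
      exact hpq
    · exact hD p' hp' q' hq'

/-- The matrix after transition `j` and state `k` have been treated. -/
noncomputable def treat (I : TransTable) (D : ℕ → ℕ → unitInterval) (j k : ℕ) : ℕ → ℕ → unitInterval :=
  -- Both raises use the gap of the original matrix, computed before the first write.
  bump (bump D (I.src j) k (I.gap D j k)) k (I.src j) (I.gap D j k)

theorem exec_stateBody (hF : I.Fits K B) {σ : State} {D : ℕ → ℕ → unitInterval} {j k : ℕ}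
    (hE : I.Env σ.reg)
    (hS : I.Stored σ.mem) (hD : I.HoldsMatrix D σ.mem) (hj : j < I.T) (hk : k < I.N)
    (ej : σ.reg 11 = j) (ei : σ.reg 12 = I.src j) (ea : σ.reg 13 = I.lab j) (ek : σ.reg 14 = k) :
    Exec K B stateBody (gapTime I.N I.T + (9 + 9)) σ fun σ' =>
      I.Stored σ'.mem ∧ I.HoldsMatrix (I.treat D j k) σ'.mem := by
  have hi := I.src_lt j hj
  refine .seq (.mono (exec_gapProg hF hE hS hD hj ej ea ek) le_rfl ?_)
  rintro σ₁ ⟨hr₁, hm₁, hg₁⟩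
  -- A raise writes only registers 25 and 26, but it may store, so nothing is claimed about the
  -- memory.
  refine .seq (.mono (.frame 25 false rfl (by simp) (exec_bumpProg hF 12 14 (by omega) (by omega)
    (hE.congr (by omega) hr₁) (hm₁ ▸ hS) (hm₁ ▸ hD) hi hk ((hr₁ _ (by omega)).trans ei)
    ((hr₁ _ (by omega)).trans ek) hg₁)) le_rfl ?_)
  rintro σ₂ ⟨hr₂, -, hS₂, hD₂⟩
  refine .mono (exec_bumpProg hF 14 12 (by omega) (by omega)
    ((hE.congr (by omega) hr₁).congr (by omega) hr₂) hS₂ hD₂ hk hi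
    ((hr₂ _ (by omega)).trans ((hr₁ _ (by omega)).trans ek))
    ((hr₂ _ (by omega)).trans ((hr₁ _ (by omega)).trans ei))
    (by rw [hr₂ _ (by omega)]; exact hg₁)) le_rfl ?_
  exact fun σ₃ => id

end TransTable

/-! ### Monotone iteration over finitely many values -/

namespace TransTable

open ArithRAM

variable {I : TransTable}

variable (I) in
/-- The gap of transition `j` and state `k` does not exceed the entries of `D` that it bounds. -/
def ClosedAt (D : ℕ → ℕ → unitInterval) (j k : ℕ) : Prop :=
  I.gap D j k ≤ D (I.src j) k ∧ I.gap D j k ≤ D k (I.src j)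

variable (I) in
-- The pre-fixpoint condition, read through the closed formula. Neither symmetry nor the triangle
-- inequality is demanded.
def Closed (D : ℕ → ℕ → unitInterval) : Prop := ∀ j < I.T, ∀ k < I.N, I.ClosedAt D j k

theorem halfDist_mono {N : ℕ} {D D' : ℕ → ℕ → unitInterval} (h : D ≤ D')
    (μ η : ℕ → unitInterval) : halfDist N D μ η ≤ halfDist N D' μ η := by
  refine Finset.sup_mono_fun fun x _ => Finset.inf_mono_fun fun y _ => ?_
  split_ifs
  · exact inf_le_inf_left _ (h x y)
  · exact le_rfl

theorem gap_mono {D D' : ℕ → ℕ → unitInterval} (h : D ≤ D') (j k : ℕ) :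
    I.gap D j k ≤ I.gap D' j k := by
  refine Finset.inf_mono_fun fun j' _ => ?_
  split_ifs
  · exact sup_le_sup (halfDist_mono h _ _) (halfDist_mono h _ _)
  all_goals exact le_rfl

theorem le_bump (D : ℕ → ℕ → unitInterval) (i k : ℕ) (g : unitInterval) : D ≤ bump D i k g := by
  intro p q
  unfold bump
  split_ifs
  · exact le_sup_left
  · exact le_rfl

theorem bump_le {D L : ℕ → ℕ → unitInterval} (h : D ≤ L) {i k : ℕ} {g : unitInterval}
    (hg : g ≤ L i k) : bump D i k g ≤ L := by
  intro p q
  unfold bump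
  split_ifs with hpq
  · rw [hpq.1, hpq.2]
    exact sup_le (h i k) hg
  · exact h p q

theorem le_treat (D : ℕ → ℕ → unitInterval) (j k : ℕ) : D ≤ I.treat D j k :=
  (le_bump _ _ _ _).trans (le_bump _ _ _ _)

theorem closedAt_of_treat_le {D : ℕ → ℕ → unitInterval} {j k : ℕ} (h : I.treat D j k ≤ D) :
    I.ClosedAt D j k := by
  constructor
  · refine le_trans ?_ (h (I.src j) k)
    refine le_trans ?_ (le_bump _ _ _ _ _ _)
    simp [bump]
  · refine le_trans ?_ (h k (I.src j))
    simp [treat, bump]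

/-- The matrix `D` lies below `L` and takes values in `V`. -/
structure Below (L : ℕ → ℕ → unitInterval) (V : Finset unitInterval)
    (D : ℕ → ℕ → unitInterval) : Prop where
  le : D ≤ L
  mem : ∀ p q, D p q ∈ V

variable (I) in
/-- `L` is the least closed matrix, and `V` is a set of values for the computation of `L`. -/
structure LeastClosed (L : ℕ → ℕ → unitInterval) (V : Finset unitInterval) : Prop where
  closed : I.Closed L
  least : ∀ D ≤ L, I.Closed D → D = L
  -- Matrices are compared on all of `ℕ`, but `level` counts only indices below `N`; this keeps
  -- strict increases inside the counted range.
  outside : ∀ p q, ¬ (p < I.N ∧ q < I.N) → L p q = ⊥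
  bot_mem : ⊥ ∈ V
  top_mem : ⊤ ∈ V
  mu_mem : ∀ j < I.T, ∀ x < I.N, I.mu j x ∈ V
  card_lt : V.card < I.len

variable {L : ℕ → ℕ → unitInterval} {V : Finset unitInterval}

/-- In a chain a join is one of its two arguments, so min-max formulas create no new values. -/
theorem sup_mem_of_mem {u v : unitInterval} (hu : u ∈ V) (hv : v ∈ V) : u ⊔ v ∈ V := by
  rcases le_total u v with h | h
  · rwa [sup_eq_right.2 h]
  · rwa [sup_eq_left.2 h]

theorem inf_mem_of_mem {u v : unitInterval} (hu : u ∈ V) (hv : v ∈ V) : u ⊓ v ∈ V := by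
  rcases le_total u v with h | h
  · rwa [inf_eq_left.2 h]
  · rwa [inf_eq_right.2 h]

theorem halfDist_mem (hL : I.LeastClosed L V) {D : ℕ → ℕ → unitInterval} (hD : ∀ p q, D p q ∈ V)
    {j : ℕ} (hj : j < I.T) (η : ℕ → unitInterval) : halfDist I.N D (I.mu j) η ∈ V := by
  refine Finset.sup_mem (V : Set unitInterval) hL.bot_mem (fun _ hu _ hv => sup_mem_of_mem hu hv)
    _ _ fun x hx => ?_
  refine Finset.inf_mem (V : Set unitInterval) hL.top_mem (fun _ hu _ hv => inf_mem_of_mem hu hv)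
    _ _ fun y _ => ?_
  split_ifs
  · exact inf_mem_of_mem (hL.mu_mem j hj x (Finset.mem_range.1 hx)) (hD x y)
  · exact hL.top_mem

theorem gap_mem (hL : I.LeastClosed L V) {D : ℕ → ℕ → unitInterval} (hD : ∀ p q, D p q ∈ V)
    {j : ℕ} (hj : j < I.T) (k : ℕ) : I.gap D j k ∈ V := by
  refine Finset.inf_mem (V : Set unitInterval) hL.top_mem (fun _ hu _ hv => inf_mem_of_mem hu hv)
    _ _ fun j' hj' => ?_
  split_ifs
  · exact sup_mem_of_mem (halfDist_mem hL hD hj _) (halfDist_mem hL hD (Finset.mem_range.1 hj') _)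
  all_goals exact hL.top_mem

theorem bump_mem {D : ℕ → ℕ → unitInterval} (hD : ∀ p q, D p q ∈ V) {g : unitInterval}
    (hg : g ∈ V) (i k p q : ℕ) : bump D i k g p q ∈ V := by
  unfold bump
  split_ifs
  · exact sup_mem_of_mem (hD p q) hg
  · exact hD p q

/-- From `D ≤ L` the gap for `D` is at most the gap for `L`, and the latter is at most the entries
of `L`, as `L` is closed. -/
theorem Below.treat (hL : I.LeastClosed L V) {D : ℕ → ℕ → unitInterval} (hD : Below L V D)
    {j k : ℕ} (hj : j < I.T) (hk : k < I.N) : Below L V (I.treat D j k) := by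
  have hg := gap_mono (I := I) hD.le j k
  have hc := hL.closed j hj k hk
  have hm := gap_mem hL hD.mem hj k
  exact ⟨bump_le (bump_le hD.le (hg.trans hc.1)) (hg.trans hc.2),
    fun p q => bump_mem (bump_mem hD.mem hm _ _) hm _ _ _ _⟩

/-- The number of increases that `D` has undergone is at most this number. -/
noncomputable def level (N : ℕ) (V : Finset unitInterval) (D : ℕ → ℕ → unitInterval) : ℕ :=
  ∑ p ∈ Finset.range N, ∑ q ∈ Finset.range N, (V.filter (· < D p q)).card

theorem level_le (N : ℕ) (V : Finset unitInterval) (D : ℕ → ℕ → unitInterval) :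
    level N V D ≤ N * N * V.card := by
  calc level N V D ≤ ∑ _p ∈ Finset.range N, ∑ _q ∈ Finset.range N, V.card :=
        Finset.sum_le_sum fun p _ => Finset.sum_le_sum fun q _ => Finset.card_filter_le _ _
    _ = N * N * V.card := by simp [mul_assoc]

/-- At an entry that grows, the old value is an element of `V` that lies strictly below the new
value but not below itself. -/
theorem level_lt (hL : I.LeastClosed L V) {D D' : ℕ → ℕ → unitInterval} (hD : Below L V D)
    (hD' : Below L V D') (h : D ≤ D') (hne : D' ≠ D) : level I.N V D < level I.N V D' := by
  obtain ⟨p, q, hpq⟩ : ∃ p q, D p q < D' p q := by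
    by_contra! hn
    exact hne (le_antisymm hn h)
  have hlt : p < I.N ∧ q < I.N := by
    by_contra hn
    have h1 := hD'.le p q
    rw [hL.outside p q hn] at h1
    exact absurd (hpq.trans_le h1) not_lt_bot
  have hm : ∀ p q, (V.filter (· < D p q)).card ≤ (V.filter (· < D' p q)).card := fun p q =>
    Finset.card_le_card fun v hv => by
      rw [Finset.mem_filter] at hv ⊢
      exact ⟨hv.1, hv.2.trans_le (h p q)⟩
  refine Finset.sum_lt_sum (fun p _ => Finset.sum_le_sum fun q _ => hm p q)
    ⟨p, Finset.mem_range.2 hlt.1, Finset.sum_lt_sum (fun q _ => hm p q)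
      ⟨q, Finset.mem_range.2 hlt.2, Finset.card_lt_card ?_⟩⟩
  refine ⟨fun v hv => ?_, fun hn => ?_⟩
  · rw [Finset.mem_filter] at hv ⊢
    exact ⟨hv.1, hv.2.trans_le (h p q)⟩
  · have := hn (Finset.mem_filter.2 ⟨hD.mem p q, hpq⟩)
    exact lt_irrefl _ (Finset.mem_filter.1 this).2

/-! ### Correctness of rounds and of the whole program -/

variable {K B : ℕ}

variable (I) in
/-- The memory holds the input and a matrix that arises from `D` by increases below `L`, and if
there were none, then `D` satisfies `C`. -/
def Raised (L : ℕ → ℕ → unitInterval) (V : Finset unitInterval) (D : ℕ → ℕ → unitInterval)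
    (C : Prop) (mem : ℕ → ℚ) : Prop :=
  I.Stored mem ∧ ∃ D', I.HoldsMatrix D' mem ∧ D ≤ D' ∧ Below L V D' ∧ (D' = D → C)

/-- Updates take effect at once, so closedness is claimed for the initial `D` only, in the case that
it survives all of them. -/
theorem exec_transBody (hF : I.Fits K B) (hL : I.LeastClosed L V) {σ : State}
    {D : ℕ → ℕ → unitInterval} {j : ℕ} (hE : I.Env σ.reg) (hS : I.Stored σ.mem)
    (hD : I.HoldsMatrix D σ.mem) (hb : Below L V D) (hj : j < I.T) (ej : σ.reg 11 = j) :
    Exec K B transBody (4 + (4 + (2 + I.N * ((gapTime I.N I.T + (9 + 9)) + 2)))) σ fun σ' =>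
      I.Raised L V D (∀ k < I.N, I.ClosedAt D j k) σ'.mem := by
  have hF' := hF
  obtain ⟨hK, hB⟩ := hF'
  have ha := src_address_lt (I := I) hj
  have hN : I.N ≤ I.len := by
    have := Nat.mul_le_mul_right (I.N + 2) (show 1 ≤ I.T by omega)
    unfold len
    omega
  refine .seq (.fetch 4 j (I.N + 2) 0 (by omega) (by omega) (by omega)
    hE.r6 ej hE.r4 hE.r5 (by omega) ?_)
  rw [hS.src j hj]
  refine .seq (.fetch 5 j (I.N + 2) 0 (by omega) (by omega) (by omega)
    (by simp [hE.r7]) (by simp [ej]) (by simp [hE.r4]) (by simp [hE.r5]) (by omega) ?_)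
  rw [State.setReg_mem, hS.lab j hj]
  refine .mono (.forTo (m := I.N) (t := gapTime I.N I.T + (9 + 9))
    (fun n σ' => I.Raised L V D (∀ k < n, I.ClosedAt D j k) σ'.mem)
    (by omega) (by omega) (by omega) (by simp [hE.r2]) (by simp [hE.r1]) (by omega) rfl ?_ ?_)
    le_rfl ?_
  · exact ⟨hS, D, hD, le_rfl, hb, fun _ k hk => absurd hk (by omega)⟩
  · rintro n hn σ' ⟨hS', D', hD', hle, hb', hC⟩ hi hr -
    refine .mono (exec_stateBody hF (D := D') (j := j) (k := n) ?_ hS' hD' hj hn ?_ ?_ ?_ hi) le_rfl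
      ?_
    · exact ((hE.setReg (by omega) _).setReg (by omega) _).congr (by omega) hr
    · rw [hr _ (by omega)]; simp [ej]
    · rw [hr _ (by omega)]; simp
    · rw [hr _ (by omega)]; simp
    · rintro σ'' ⟨hS'', hD''⟩
      refine ⟨hS'', _, hD'', hle.trans (le_treat _ _ _), hb'.treat hL hj hn, fun h k hk => ?_⟩
      -- Entries only grow: a matrix that equals `D` after this update was `D` before it, so the gap
      -- was computed from `D`.
      have he : D' = D := le_antisymm ((le_treat D' j n).trans h.le) hle
      rcases Nat.lt_succ_iff_lt_or_eq.1 hk with hk | rfl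
      · exact hC he k hk
      · rw [he] at h
        exact closedAt_of_treat_le h.le
  · rintro σ' ⟨-, -, hI⟩
    exact hI

theorem exec_roundProg (hF : I.Fits K B) (hL : I.LeastClosed L V) {σ : State}
    {D : ℕ → ℕ → unitInterval} (hE : I.Env σ.reg) (hS : I.Stored σ.mem)
    (hD : I.HoldsMatrix D σ.mem) (hb : Below L V D) :
    Exec K B roundProg (roundTime I.N I.T) σ fun σ' =>
      I.Raised L V D (I.Closed D) σ'.mem := by
  have hF' := hF
  obtain ⟨hK, hB⟩ := hF'
  have hT : I.T ≤ I.len := by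
    have := Nat.mul_le_mul_left I.T (show 1 ≤ I.N + 2 by omega)
    unfold len
    omega
  refine .mono (.forTo (m := I.T)
    (t := 4 + (4 + (2 + I.N * ((gapTime I.N I.T + (9 + 9)) + 2))))
    (fun n σ' => I.Raised L V D (∀ j < n, ∀ k < I.N, I.ClosedAt D j k) σ'.mem)
    (by omega) (by omega) (by omega) (by simp [hE.r3]) (by simp [hE.r1]) (by omega) rfl ?_ ?_)
    le_rfl ?_
  · exact ⟨hS, D, hD, le_rfl, hb, fun _ k hk => absurd hk (by omega)⟩
  · rintro n hn σ' ⟨hS', D', hD', hle, hb', hC⟩ hi hr -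
    refine .mono (exec_transBody hF hL (hE.congr (by omega) hr) hS' hD' hb' hn hi) le_rfl ?_
    rintro σ'' ⟨hS'', D'', hD'', hle', hb'', hC'⟩
    refine ⟨hS'', _, hD'', hle.trans hle', hb'', fun h j hj => ?_⟩
    have he : D' = D := le_antisymm (hle'.trans h.le) hle
    rcases Nat.lt_succ_iff_lt_or_eq.1 hj with hj | rfl
    · exact hC he j hj
    · rw [he] at hC'
      exact hC' h
  · rintro σ' ⟨-, -, hI⟩
    exact hI

/-- After `n` rounds the matrix is `L` or its level is at least `n`: an unchanged matrix is closed
below `L`, hence `L`. The second alternative fails for `n = N * N * len`, since levels are at most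
`N * N * V.card` and `V.card < len`. -/
theorem exec_rounds (hF : I.Fits K B) (hL : I.LeastClosed L V) {σ : State}
    (hE : I.Env σ.reg) (hR : σ.reg 9 = (I.N * I.N * I.len : ℕ)) (hS : I.Stored σ.mem)
    (hD : I.HoldsMatrix (fun _ _ => ⊥) σ.mem) :
    Exec K B (.forTo 10 9 roundProg) (2 + I.N * I.N * I.len * (roundTime I.N I.T + 2)) σ fun σ' =>
      I.Env σ'.reg ∧ I.Stored σ'.mem ∧ I.HoldsMatrix L σ'.mem := by
  have hF' := hF
  obtain ⟨hK, hB⟩ := hF'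
  refine .mono (.forTo (m := I.N * I.N * I.len) (t := roundTime I.N I.T)
    (fun n σ' => I.Stored σ'.mem ∧ ∃ D, I.HoldsMatrix D σ'.mem ∧ Below L V D ∧
      (D = L ∨ n ≤ level I.N V D))
    (by omega) (by omega) (by omega) hR (by simp [hE.r1]) (by omega) rfl ?_ ?_)
    le_rfl ?_
  · exact ⟨hS, _, hD, ⟨fun _ _ => bot_le, fun _ _ => hL.bot_mem⟩, Or.inr (Nat.zero_le _)⟩
  · rintro n hn σ' ⟨hS', D, hD', hb, hC⟩ hi hr -
    refine .mono (exec_roundProg hF hL (hE.congr (by omega) hr) hS' hD' hb) le_rfl ?_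
    rintro σ'' ⟨hS'', D', hD'', hle, hb', hC'⟩
    refine ⟨hS'', D', hD'', hb', ?_⟩
    rcases hC with rfl | hC
    · exact Or.inl (le_antisymm hb'.le hle)
    · by_cases he : D' = D
      · exact Or.inl (he.trans (hL.least D hb.le (hC' he)))
      · exact Or.inr (hC.trans_lt (level_lt hL hb hb' hle he))
  · rintro σ' ⟨hr, -, hS', D, hD', -, hC⟩
    refine ⟨hE.congr (by omega) hr, hS', ?_⟩
    rcases hC with rfl | hC
    · exact hD'
    · have hN := I.fst_lt
      have h1 := hC.trans (level_le I.N V D)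
      have h2 := Nat.le_of_mul_le_mul_left h1 (Nat.mul_pos (by omega : 0 < I.N) (by omega))
      exact absurd hL.card_lt (by omega)

theorem exec_initProg (hF : I.Fits K B) {σ : State} (hS : I.Stored σ.mem)
    (h0 : σ.reg 0 = I.len) (h5 : σ.reg 5 = 0) :
    Exec K B initProg 10 σ fun σ' =>
      σ'.mem = σ.mem ∧ I.Env σ'.reg ∧ σ'.reg 9 = (I.N * I.N * I.len : ℕ) := by
  obtain ⟨hK, hB⟩ := hF
  -- Without transitions `len` is 4 and need not bound `N`; the product does, as `N` and `len` are
  -- positive.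
  have hlen : I.N < I.N * I.N * I.len + 10 := by
    have h1 : 1 ≤ I.N * I.len :=
      Nat.mul_pos (by have := I.fst_lt; omega) (by unfold len; omega)
    have h2 := Nat.mul_le_mul_left I.N h1
    rw [← mul_assoc] at h2
    omega
  have hNN : I.N * I.N ≤ K := by omega
  refine .seq (n' := 9) (.const 1 (by omega) (by omega) ?_)
  refine .seq (n' := 8) (.load 0 (by omega) (by simp [h5]) ?_)
  refine .seq (n' := 7) (.load 1 (by omega) (by simp) ?_)
  refine .seq (n' := 6) (.const 2 (by omega) (by omega) ?_)
  refine .seq (n' := 5) (.add I.N 2 (by omega) (by simp [hS.states]) (by simp) (by omega) ?_)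
  refine .seq (n' := 4) (.const 4 (by omega) (by omega) ?_)
  refine .seq (n' := 3) (.const 5 (by omega) (by omega) ?_)
  refine .seq (n' := 2) (.const 6 (by omega) (by omega) ?_)
  refine .seq (n' := 1) (.mul I.N I.N (by omega) (by simp [hS.states]) (by simp [hS.states])
    (by omega) ?_)
  refine .mul (I.N * I.N) I.len (by omega) (by simp) (by simp [h0]) (by omega) ?_
  refine ⟨rfl, ?_, by simp⟩
  constructor <;> simp [h0, h5, hS.states, hS.transitions]

theorem exec_outputProg (hF : I.Fits K B) {σ : State} (hE : I.Env σ.reg) (hS : I.Stored σ.mem)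
    (hD : I.HoldsMatrix L σ.mem) :
    Exec K B outputProg 9 σ fun σ' => UnitRep (σ'.reg 0) (L I.fst I.snd) := by
  obtain ⟨hK, hB⟩ := hF
  have ha := matrix_address_lt I.fst_lt I.snd_lt
  refine .seq (n' := 8) (.const 2 (by omega) (by omega) ?_)
  refine .seq (n' := 7) (.load 2 (by omega) (by simp) ?_)
  refine .seq (n' := 6) (.const 3 (by omega) (by omega) ?_)
  refine .seq (n' := 5) (.load 3 (by omega) (by simp) ?_)
  refine .seq (n := 4) (n' := 1) (.fetch I.len I.fst I.N I.snd (by omega) (by omega) (by omega)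
    (by simp [hE.r0]) (by simp [hS.fst]) (by simp [hE.r2]) (by simp [hS.snd]) (by omega) ?_)
  refine .move (by omega) ?_
  simpa using hD _ I.fst_lt _ I.snd_lt

/-- A time bound for the whole program. -/
def mainTime (N T : ℕ) : ℕ :=
  10 + ((2 + N * N * (4 + T * (N + 2)) * (roundTime N T + 2)) + 9)

theorem exec_mainProg (hF : I.Fits K B) (hL : I.LeastClosed L V) {σ : State}
    (hS : I.Stored σ.mem) (h0 : σ.reg 0 = I.len) (h5 : σ.reg 5 = 0)
    (hmem : ∀ k, I.len ≤ k → σ.mem k = 0) :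
    Exec K B mainProg (mainTime I.N I.T) σ fun σ' => UnitRep (σ'.reg 0) (L I.fst I.snd) := by
  refine .seq (.mono (exec_initProg hF hS h0 h5) le_rfl ?_)
  rintro σ₁ ⟨hm, hE, hR⟩
  refine .seq (.mono (exec_rounds hF hL hE hR (hm ▸ hS) fun p hp q hq => ?_) le_rfl ?_)
  -- Unused cells hold 0, so the zero matrix is in place without any initialisation.
  · rw [hm, hmem _ (by omega)]
    exact unitRep_zero
  · rintro σ₂ ⟨hE₂, hS₂, hD₂⟩
    exact exec_outputProg hF hE₂ hS₂ hD₂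

end TransTable

/-! ### The closed formula for the lifting -/

/-- One half of the closed formula for the lifting. -/
noncomputable def semiLift {S : Type*} (d : S → S → unitInterval) (μ η : FuzzySet S) :
    unitInterval :=
  ⨆ x, ⨅ y, if μ x ≤ η y then μ x ⊓ d x y else ⊤

theorem semiLift_mono {S : Type*} {d e : S → S → unitInterval} (h : ∀ s t, d s t ≤ e s t)
    (μ η : FuzzySet S) : semiLift d μ η ≤ semiLift e μ η := by
  refine iSup_mono fun x => iInf_mono fun y => ?_
  split_ifs
  · exact inf_le_inf_left _ (h x y)
  · exact le_rfl

/-- In row `s` the supremum `μ s` is attained at some `t`. There `μ s = x s t ≤ η t`, so `t` is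
admissible in the infimum and its term is part of the cost. -/
theorem semiLift_le_of_isCoupling {S : Type*} [Finite S] (d : S → S → unitInterval)
    {μ η : FuzzySet S} {x : S → S → unitInterval} (hx : IsCoupling μ η x) :
    semiLift d μ η ≤ ⨆ s, ⨆ t, d s t ⊓ x s t := by
  refine iSup_le fun s => ?_
  have : Nonempty S := ⟨s⟩
  obtain ⟨t, ht⟩ := exists_eq_ciSup_of_finite (f := fun t => x s t)
  have h1 : x s t = μ s := ht.trans (hx.1 s)
  have h2 : x s t ≤ η t := (le_iSup (fun s => x s t) s).trans (hx.2 t).le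
  refine (iInf_le _ t).trans ?_
  rw [if_pos (h1 ▸ h2), ← h1, inf_comm]
  exact le_iSup₂_of_le (f := fun s t => d s t ⊓ x s t) s t le_rfl

/-- A state whose degree in `μ` exceeds all degrees in `η` has no admissible partner. -/
theorem semiLift_eq_top {S : Type*} [Finite S] (d : S → S → unitInterval) {μ η : FuzzySet S}
    (h : ⨆ s, η s < ⨆ s, μ s) : semiLift d μ η = ⊤ := by
  obtain ⟨s, hs⟩ := lt_iSup_iff.1 h
  refine top_le_iff.1 (le_iSup_of_le s (le_iInf fun t => ?_))
  rw [if_neg (not_le.2 ((le_iSup η t).trans_lt hs))]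

/-- A row condition for the coupling of least cost at most `r`. -/
theorem exists_le_of_semiLift_le {S : Type*} [Finite S] {d : S → S → unitInterval}
    {μ η : FuzzySet S} {r : unitInterval} (h : ⨆ s, μ s = ⨆ s, η s) (hr : semiLift d μ η ≤ r)
    (s : S) : ∃ t, μ s ≤ η t ∧ (d s t ≤ r ∨ μ s ≤ r) := by
  have : Nonempty S := ⟨s⟩
  -- A degree at most `r` costs at most `r` anywhere, so a maximiser of `η` will do. A larger one
  -- needs a minimiser in the formula, whose distance is then at most `r`.
  rcases le_or_gt (μ s) r with hs | hs
  · obtain ⟨t, ht⟩ := exists_eq_ciSup_of_finite (f := η)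
    exact ⟨t, by rw [ht, ← h]; exact le_iSup μ s, Or.inr hs⟩
  · obtain ⟨t, ht⟩ := exists_eq_ciInf_of_finite
      (f := fun t => if μ s ≤ η t then μ s ⊓ d s t else ⊤)
    have h1 : (if μ s ≤ η t then μ s ⊓ d s t else ⊤) ≤ r := by
      rw [ht]
      exact (le_iSup (fun s => ⨅ t, if μ s ≤ η t then μ s ⊓ d s t else ⊤) s).trans hr
    split_ifs at h1 with h2
    · exact ⟨t, h2, Or.inl ((inf_le_iff.1 h1).resolve_left (not_le.2 hs))⟩
    · exact absurd (h1.trans_lt hs) not_top_lt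

/-- Each half bounds the cost of every coupling from below, the second one through the transposed
coupling. Conversely, a single coupling has cost at most the maximum of the halves. Of the
properties of `d` only symmetry enters. -/
theorem liftDist_eq {S : Type*} [Finite S] (d : PseudoUltrametric S) (μ η : FuzzySet S) :
    liftDist d.dist μ η = semiLift d.dist μ η ⊔ semiLift d.dist η μ := by
  unfold liftDist
  split_ifs with h
  · refine le_antisymm ?_ (le_iInf₂ fun x hx => sup_le (semiLift_le_of_isCoupling _ hx) ?_)
    · set r := semiLift d.dist μ η ⊔ semiLift d.dist η μ with hr
      -- The largest matrix with entries below `μ s` and `η t` and with cost at most `r`. If any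
      -- coupling has cost at most `r`, so has this one.
      refine iInf₂_le_of_le (fun s t => μ s ⊓ η t ⊓ if d.dist s t ≤ r then ⊤ else r)
        ⟨fun s => ?_, fun t => ?_⟩ (iSup₂_le fun s t => ?_)
      · refine le_antisymm (iSup_le fun t => inf_le_left.trans inf_le_left) ?_
        obtain ⟨t, h1, h2⟩ := exists_le_of_semiLift_le h (le_sup_left.trans hr.ge) s
        refine le_iSup_of_le t (le_inf (le_inf le_rfl h1) ?_)
        split_ifs with h3
        · exact le_top
        · exact h2.resolve_left h3
      · refine le_antisymm (iSup_le fun s => inf_le_left.trans inf_le_right) ?_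
        obtain ⟨s, h1, h2⟩ := exists_le_of_semiLift_le h.symm (le_sup_right.trans hr.ge) t
        refine le_iSup_of_le s (le_inf (le_inf h1 le_rfl) ?_)
        split_ifs with h3
        · exact le_top
        · rw [d.dist_comm] at h3
          exact h2.resolve_left h3
      · dsimp only
        split_ifs with h3
        · exact inf_le_left.trans h3
        · exact inf_le_right.trans inf_le_right
    · refine (semiLift_le_of_isCoupling (x := fun s t => x t s) d.dist ⟨hx.2, hx.1⟩).trans ?_
      refine iSup₂_le fun s t => ?_
      rw [d.dist_comm s t]
      exact le_iSup₂_of_le (f := fun s t => d.dist s t ⊓ x s t) t s le_rfl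
  · refine (top_le_iff.1 ?_).symm
    rcases lt_or_gt_of_ne h with h | h
    · exact le_sup_of_le_right (semiLift_eq_top _ h).ge
    · exact le_sup_of_le_left (semiLift_eq_top _ h).ge

/-! ### The functional without discount and its least fixpoint -/

theorem Delta_one_dist {S A : Type*} (M : FTS S A) (d : PseudoUltrametric S) (s t : S) :
    (M.Delta 1 d).dist s t = ⨆ a, hausdorffDist (liftDist d.dist) (M.δ s a) (M.δ t a) :=
  one_mul _

theorem hausdorffDist_lfp_le {S A : Type*} (M : FTS S A) (s t : S) (a : A) :
    hausdorffDist (liftDist (OrderHom.lfp (M.Delta 1)).dist) (M.δ s a) (M.δ t a)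
      ≤ (OrderHom.lfp (M.Delta 1)).dist s t := by
  conv_rhs => rw [← OrderHom.map_lfp (M.Delta 1), Delta_one_dist]
  exact le_iSup (fun a => hausdorffDist (liftDist (OrderHom.lfp (M.Delta 1)).dist)
    (M.δ s a) (M.δ t a)) a

theorem sup_range_eq_iSup {S : Type*} {n : ℕ} (e : S ≃ Fin n) (f : ℕ → unitInterval) :
    (Finset.range n).sup f = ⨆ s, f (e s) := by
  refine le_antisymm (Finset.sup_le fun x hx => ?_)
    (iSup_le fun s => Finset.le_sup (Finset.mem_range.2 (e s).2))
  refine le_iSup_of_le (e.symm ⟨x, Finset.mem_range.1 hx⟩) ?_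
  simp

theorem inf_range_eq_iInf {S : Type*} {n : ℕ} (e : S ≃ Fin n) (f : ℕ → unitInterval) :
    (Finset.range n).inf f = ⨅ s, f (e s) := by
  refine le_antisymm (le_iInf fun s => Finset.inf_le (Finset.mem_range.2 (e s).2))
    (Finset.le_inf fun x hx => ?_)
  refine iInf_le_of_le (e.symm ⟨x, Finset.mem_range.1 hx⟩) ?_
  simp

/-! ### From presentations of rational systems to transition tables -/

namespace RatFTS

variable {S A : Type*}

/-- The fuzzy set with the given rational membership degrees. -/
noncomputable def toFuzzy (μ : S → ℚ) : FuzzySet S :=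
  fun x => Set.projIcc (0 : ℝ) 1 zero_le_one (μ x)

theorem coe_toFuzzy (M : RatFTS S A) {s : S} {a : A} {μ : S → ℚ} (h : μ ∈ M.tr s a) (x : S) :
    (toFuzzy μ x : ℝ) = (μ x : ℝ) := by
  have h' := M.mem_unit s a μ h x
  unfold toFuzzy
  rw [Set.projIcc_of_mem]
  exact ⟨by exact_mod_cast h'.1, by exact_mod_cast h'.2⟩

theorem mem_toFTS_iff (M : RatFTS S A) {s : S} {a : A} {ν : FuzzySet S} :
    ν ∈ M.toFTS.δ s a ↔ ∃ μ ∈ M.tr s a, ν = toFuzzy μ := by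
  constructor
  · rintro ⟨μ, hμ, h⟩
    exact ⟨μ, hμ, funext fun x => Subtype.ext ((h x).trans (M.coe_toFuzzy hμ x).symm)⟩
  · rintro ⟨μ, hμ, rfl⟩
    exact ⟨μ, hμ, M.coe_toFuzzy hμ⟩

namespace Presentation

variable [Fintype S] {M : RatFTS S A}

/-- The transition table that a presentation describes. -/
noncomputable def table (P : M.Presentation) (s t : S) : TransTable where
  N := Fintype.card S
  T := P.trans.length
  src j := if h : j < P.trans.length then P.state P.trans[j].1 else 0
  lab j := if h : j < P.trans.length then P.label P.trans[j].2.1 else 0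
  mu j x := if h : j < P.trans.length ∧ x < Fintype.card S then
    toFuzzy P.trans[j].2.2 (P.state.symm ⟨x, h.2⟩) else ⊥
  fst := P.state s
  snd := P.state t
  src_lt j h := by
    rw [dif_pos h]
    exact Fin.is_lt _
  fst_lt := Fin.is_lt _
  snd_lt := Fin.is_lt _

variable (P : M.Presentation) (s₀ t₀ : S)

theorem table_mu {j : ℕ} (h : j < P.trans.length) (x : S) :
    (P.table s₀ t₀).mu j (P.state x) = toFuzzy P.trans[j].2.2 x := by
  simp [table, h]

theorem table_src {j : ℕ} (h : j < P.trans.length) :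
    (P.table s₀ t₀).src j = P.state P.trans[j].1 := by
  simp [table, h]

theorem table_lab {j : ℕ} (h : j < P.trans.length) :
    (P.table s₀ t₀).lab j = P.label P.trans[j].2.1 := by
  simp [table, h]

/-- A matrix as a function of two states. -/
def onStates (P : M.Presentation) (D : ℕ → ℕ → unitInterval) (s t : S) : unitInterval :=
  D (P.state s) (P.state t)

theorem table_halfDist (D : ℕ → ℕ → unitInterval) {j j' : ℕ} (h : j < P.trans.length)
    (h' : j' < P.trans.length) :
    halfDist (P.table s₀ t₀).N D ((P.table s₀ t₀).mu j) ((P.table s₀ t₀).mu j') =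
      semiLift (P.onStates D) (toFuzzy P.trans[j].2.2) (toFuzzy P.trans[j'].2.2) := by
  unfold halfDist semiLift
  rw [show (P.table s₀ t₀).N = Fintype.card S from rfl, sup_range_eq_iSup P.state]
  refine iSup_congr fun x => ?_
  rw [inf_range_eq_iInf P.state]
  refine iInf_congr fun y => ?_
  rw [P.table_mu s₀ t₀ h, P.table_mu s₀ t₀ h']
  rfl

theorem trans_mem {j : ℕ} (h : j < P.trans.length) :
    P.trans[j].2.2 ∈ M.tr P.trans[j].1 P.trans[j].2.1 :=
  (P.mem_trans _ _ _).1 (List.getElem_mem h)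

theorem exists_trans {s : S} {a : A} {μ : S → ℚ} (h : μ ∈ M.tr s a) :
    ∃ (j : ℕ) (hj : j < P.trans.length), P.trans[j] = (s, a, μ) :=
  List.mem_iff_getElem.1 ((P.mem_trans s a μ).2 h)

/-- The closed formula for the lifting of the distance given by a matrix. -/
noncomputable def hatOnStates (P : M.Presentation) (D : ℕ → ℕ → unitInterval)
    (μ η : FuzzySet S) : unitInterval :=
  semiLift (P.onStates D) μ η ⊔ semiLift (P.onStates D) η μ

theorem table_gap (D : ℕ → ℕ → unitInterval) {j : ℕ} (h : j < P.trans.length) (t : S) :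
    (P.table s₀ t₀).gap D j (P.state t) =
      ⨅ η ∈ M.toFTS.δ t P.trans[j].2.1, P.hatOnStates D (toFuzzy P.trans[j].2.2) η := by
  refine le_antisymm (le_iInf₂ fun ν hν => ?_) (Finset.le_inf fun j' hj' => ?_)
  · obtain ⟨η, hη, rfl⟩ := M.mem_toFTS_iff.1 hν
    obtain ⟨j', hj', e⟩ := P.exists_trans hη
    refine (Finset.inf_le (Finset.mem_range.2 hj')).trans ?_
    rw [P.table_src s₀ t₀ hj', P.table_lab s₀ t₀ hj', P.table_lab s₀ t₀ h, e, if_pos rfl,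
      if_pos rfl]
    unfold TransTable.hat
    rw [P.table_halfDist s₀ t₀ D h hj', P.table_halfDist s₀ t₀ D hj' h, e]
    exact le_rfl
  · replace hj' : j' < P.trans.length := Finset.mem_range.1 hj'
    rw [P.table_src s₀ t₀ hj', P.table_lab s₀ t₀ hj', P.table_lab s₀ t₀ h]
    split_ifs with h1 h2
    · have hm := P.trans_mem hj'
      -- Numbers identify only labels that occur, and both labels here belong to listed transitions.
      rw [P.label_inj ⟨_, _, hm⟩ ⟨_, _, P.trans_mem h⟩ h2,
        P.state.injective (Fin.val_injective h1)] at hm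
      refine iInf₂_le_of_le (toFuzzy P.trans[j'].2.2) (M.mem_toFTS_iff.2 ⟨_, hm, rfl⟩) ?_
      unfold TransTable.hat
      rw [P.table_halfDist s₀ t₀ D h hj', P.table_halfDist s₀ t₀ D hj' h]
      exact le_rfl
    all_goals exact le_top

/-! ### The behavioural distance is the least closed matrix -/

/-- The matrix of the behavioural distance. -/
noncomputable def distMatrix (P : M.Presentation) : ℕ → ℕ → unitInterval := fun p q =>
  if h : p < Fintype.card S ∧ q < Fintype.card S then
    M.toFTS.behDist 1 (P.state.symm ⟨p, h.1⟩) (P.state.symm ⟨q, h.2⟩) else ⊥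

theorem onStates_distMatrix :
    P.onStates P.distMatrix = (OrderHom.lfp (M.toFTS.Delta 1)).dist := by
  funext s t
  simp [onStates, distMatrix, FTS.behDist]

theorem hatOnStates_distMatrix (μ η : FuzzySet S) :
    P.hatOnStates P.distMatrix μ η = liftDist (OrderHom.lfp (M.toFTS.Delta 1)).dist μ η := by
  rw [liftDist_eq, hatOnStates, onStates_distMatrix]

/-- Each gap is one term of a Hausdorff distance, which the fixpoint equation bounds by the entry;
it occurs in the left half for one order of the states and in the right half for the other. -/
theorem closed_distMatrix : (P.table s₀ t₀).Closed P.distMatrix := by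
  intro j hj k hk
  replace hj : j < P.trans.length := hj
  obtain ⟨t, rfl⟩ : ∃ t, ((P.state t : Fin _) : ℕ) = k := ⟨P.state.symm ⟨k, hk⟩, by simp⟩
  unfold TransTable.ClosedAt
  rw [P.table_gap s₀ t₀ _ hj, P.table_src s₀ t₀ hj]
  simp only [hatOnStates_distMatrix]
  have hμ : toFuzzy P.trans[j].2.2 ∈ M.toFTS.δ P.trans[j].1 P.trans[j].2.1 :=
    M.mem_toFTS_iff.2 ⟨_, P.trans_mem hj, rfl⟩
  constructor
  · refine le_trans ?_ (congrFun₂ P.onStates_distMatrix P.trans[j].1 t).ge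
    refine le_trans ?_ (hausdorffDist_lfp_le _ _ _ P.trans[j].2.1)
    refine le_sup_of_le_left ?_
    exact le_iSup₂_of_le (f := fun μ (_ : μ ∈ M.toFTS.δ P.trans[j].1 P.trans[j].2.1) =>
      ⨅ η ∈ M.toFTS.δ t P.trans[j].2.1, liftDist (OrderHom.lfp (M.toFTS.Delta 1)).dist μ η)
      _ hμ le_rfl
  · refine le_trans ?_ (congrFun₂ P.onStates_distMatrix t P.trans[j].1).ge
    refine le_trans ?_ (hausdorffDist_lfp_le _ _ _ P.trans[j].2.1)
    refine le_sup_of_le_right ?_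
    exact le_iSup₂_of_le (f := fun μ (_ : μ ∈ M.toFTS.δ P.trans[j].1 P.trans[j].2.1) =>
      ⨅ η ∈ M.toFTS.δ t P.trans[j].2.1, liftDist (OrderHom.lfp (M.toFTS.Delta 1)).dist μ η)
      _ hμ le_rfl

/-- A closed `D` need not be a pseudo-ultrametric, so `Delta` cannot be applied to it. The closed
formula can, and its monotonicity carries the bound from `d` to `Delta 1 d`. -/
theorem Delta_le_of_closed {D : ℕ → ℕ → unitInterval} (hD : (P.table s₀ t₀).Closed D)
    {d : PseudoUltrametric S} (hd : ∀ s t, d.dist s t ≤ P.onStates D s t) (s t : S) :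
    (M.toFTS.Delta 1 d).dist s t ≤ P.onStates D s t := by
  have key : ∀ (s t : S) (a : A), ∀ μ ∈ M.toFTS.δ s a,
      (⨅ η ∈ M.toFTS.δ t a, liftDist d.dist μ η) ≤ P.onStates D s t ∧
        (⨅ η ∈ M.toFTS.δ t a, liftDist d.dist μ η) ≤ P.onStates D t s := by
    intro s t a ν hν
    obtain ⟨μ, hμ, rfl⟩ := M.mem_toFTS_iff.1 hν
    obtain ⟨j, hj, e⟩ := P.exists_trans hμ
    have hc := hD j hj (P.state t) (Fin.is_lt _)
    unfold TransTable.ClosedAt at hc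
    rw [P.table_gap s₀ t₀ D hj, P.table_src s₀ t₀ hj, e] at hc
    have hle : (⨅ η ∈ M.toFTS.δ t a, liftDist d.dist (toFuzzy μ) η) ≤
        ⨅ η ∈ M.toFTS.δ t a, P.hatOnStates D (toFuzzy μ) η :=
      iInf₂_mono fun η _ => by
        rw [liftDist_eq]
        exact sup_le_sup (semiLift_mono hd _ _) (semiLift_mono hd _ _)
    exact ⟨hle.trans hc.1, hle.trans hc.2⟩
  rw [Delta_one_dist]
  refine iSup_le fun a => sup_le (iSup₂_le fun μ hμ => (key s t a μ hμ).1)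
    (iSup₂_le fun η hη => (key t s a η hη).2)

/-- Lying below `D` is preserved by the functional and by suprema of pseudo-ultrametrics, because
these are pointwise. Fixpoint induction then applies. -/
theorem distMatrix_le_of_closed {D : ℕ → ℕ → unitInterval} (hD : (P.table s₀ t₀).Closed D) :
    P.distMatrix ≤ D := by
  have key : ∀ s t, (OrderHom.lfp (M.toFTS.Delta 1)).dist s t ≤ P.onStates D s t := by
    refine OrderHom.lfp_induction (M.toFTS.Delta 1)
      (p := fun d => ∀ s t, d.dist s t ≤ P.onStates D s t) ?_ ?_
    · exact fun d hd _ => P.Delta_le_of_closed s₀ t₀ hD hd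
    · exact fun F hF s t => iSup₂_le fun d hd => hF d hd s t
  intro p q
  unfold distMatrix
  split_ifs with h
  · simpa [onStates, FTS.behDist] using
      key (P.state.symm ⟨p, h.1⟩) (P.state.symm ⟨q, h.2⟩)
  · exact bot_le

open Classical in
/-- The values that occur in the computation. -/
noncomputable def values (P : M.Presentation) (s₀ t₀ : S) : Finset unitInterval :=
  insert ⊥ (insert ⊤ ((Finset.range P.trans.length ×ˢ Finset.range (Fintype.card S)).image
    fun z => (P.table s₀ t₀).mu z.1 z.2))

theorem leastClosed_distMatrix :
    (P.table s₀ t₀).LeastClosed P.distMatrix (P.values s₀ t₀) where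
  closed := P.closed_distMatrix s₀ t₀
  least D hle hD := le_antisymm hle (P.distMatrix_le_of_closed s₀ t₀ hD)
  outside p q h := dif_neg h
  bot_mem := by simp [values]
  top_mem := by simp [values]
  mu_mem j hj x hx := by
    classical
    exact Finset.mem_insert_of_mem (Finset.mem_insert_of_mem (Finset.mem_image.2
      ⟨(j, x), Finset.mem_product.2 ⟨Finset.mem_range.2 hj, Finset.mem_range.2 hx⟩, rfl⟩))
  card_lt := by
    classical
    -- There are at most `T * N + 2` values, fewer than `len = 4 + T * (N + 2)`.
    have h1 := (Finset.card_insert_le (⊥ : unitInterval) _).trans (Nat.succ_le_succ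
      ((Finset.card_insert_le (⊤ : unitInterval) _).trans (Nat.succ_le_succ
        (Finset.card_image_le (s := Finset.range P.trans.length ×ˢ Finset.range (Fintype.card S))
          (f := fun z => (P.table s₀ t₀).mu z.1 z.2)))))
    rw [Finset.card_product, Finset.card_range, Finset.card_range] at h1
    refine lt_of_le_of_lt h1 ?_
    change _ < 4 + P.trans.length * (Fintype.card S + 2)
    rw [Nat.mul_add]
    omega

end Presentation

end RatFTS

/-! ### The input word, its length and its bit size -/

theorem List.getElem?_flatMap_of_length_eq {α β : Type*} {f : α → List β} {m : ℕ} (l : List α)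
    (hf : ∀ a ∈ l, (f a).length = m) {j r : ℕ} (hj : j < l.length) (hr : r < m) :
    (l.flatMap f)[j * m + r]? = (f l[j])[r]? := by
  induction l generalizing j with
  | nil => simp at hj
  | cons a l ih =>
    have ha : (f a).length = m := hf a (by simp)
    rw [List.flatMap_cons]
    cases j with
    | zero =>
      rw [List.getElem?_append_left (by omega)]
      simp
    | succ j =>
      rw [List.getElem?_append_right (by rw [ha, Nat.succ_mul]; omega), ha, Nat.succ_mul,
        show j * m + m + r - m = j * m + r by omega,
        ih (fun b hb => hf b (by simp [hb])) (by simpa using hj)]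
      simp

theorem List.length_flatMap_of_length_eq {α β : Type*} {f : α → List β} {m : ℕ} (l : List α)
    (hf : ∀ a ∈ l, (f a).length = m) : (l.flatMap f).length = l.length * m := by
  induction l with
  | nil => simp
  | cons a l ih =>
    rw [List.flatMap_cons, List.length_append, hf a (by simp),
      ih fun b hb => hf b (by simp [hb]), List.length_cons, Nat.succ_mul, add_comm]

theorem ArithRAM.State.init_mem (w : List ℚ) (k : ℕ) :
    (ArithRAM.State.init w).mem k = w.getD k 0 := by
  simp only [ArithRAM.State.init, Finsupp.coe_finsetSum, Finset.sum_apply,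
    Finsupp.single_apply, Finset.sum_ite_eq', Finset.mem_range]
  split_ifs with h
  · rfl
  · rw [List.getD_eq_default _ _ (by omega)]

theorem one_le_ratBits (q : ℚ) : 1 ≤ ratBits q := by
  have : 0 < q.den.size := Nat.size_pos.2 q.den_pos
  unfold ratBits
  omega

namespace RatFTS

variable {S A : Type*} [Fintype S]

theorem size_le_bitSize [Fintype A] (M : RatFTS S A) : M.size ≤ M.bitSize := by
  unfold size bitSize
  refine Nat.add_le_add_left (Finset.sum_le_sum fun s _ => Finset.sum_le_sum fun a _ =>
    Finset.sum_le_sum fun μ _ => ?_) _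
  rw [Finset.card_eq_sum_ones]
  exact Finset.sum_le_sum fun x _ => one_le_ratBits _

theorem ratBits_le_bitSize [Fintype A] (M : RatFTS S A) {s : S} {a : A} {μ : S → ℚ} (h : μ ∈ M.tr s a)
    (x : S) : ratBits (μ x) ≤ M.bitSize := by
  rcases (M.mem_unit s a μ h x).1.eq_or_lt with h0 | h0
  -- A zero degree is not counted in the sums of `bitSize`, but its single bit is paid for by the
  -- summand `|S|`.
  · rw [← h0]
    have h1 : 0 < Fintype.card S := Fintype.card_pos_iff.2 ⟨x⟩
    have h2 : ratBits 0 = 1 := by decide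
    rw [h2]
    exact Nat.le_add_right_of_le h1
  · refine le_trans ?_ (Nat.le_add_left _ _)
    calc ratBits (μ x) ≤ ∑ x ∈ Finset.univ.filter (fun x => 0 < μ x), ratBits (μ x) :=
          Finset.single_le_sum (f := fun x => ratBits (μ x)) (fun _ _ => Nat.zero_le _)
            (by simpa using h0)
      _ ≤ ∑ μ ∈ M.tr s a, ∑ x ∈ Finset.univ.filter (fun x => 0 < μ x), ratBits (μ x) :=
          Finset.single_le_sum (f := fun μ : S → ℚ =>
            ∑ x ∈ Finset.univ.filter (fun x => 0 < μ x), ratBits (μ x))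
            (fun _ _ => Nat.zero_le _) h
      _ ≤ ∑ a, ∑ μ ∈ M.tr s a, ∑ x ∈ Finset.univ.filter (fun x => 0 < μ x), ratBits (μ x) :=
          Finset.single_le_sum (f := fun a => ∑ μ ∈ M.tr s a,
            ∑ x ∈ Finset.univ.filter (fun x => 0 < μ x), ratBits (μ x))
            (fun _ _ => Nat.zero_le _) (Finset.mem_univ a)
      _ ≤ _ := Finset.single_le_sum (f := fun s => ∑ a, ∑ μ ∈ M.tr s a,
            ∑ x ∈ Finset.univ.filter (fun x => 0 < μ x), ratBits (μ x))
            (fun _ _ => Nat.zero_le _) (Finset.mem_univ s)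

namespace Presentation

variable {M : RatFTS S A} (P : M.Presentation)

/-- A listed transition contributes at least 1 to `size` if its support is nonempty, and 1 to
`numEmpty` otherwise. The list has no repetitions. -/
theorem length_trans_le [Fintype A] : P.trans.length ≤ M.size + M.numEmpty := by
  classical
  have h1 : P.trans.length ≤ ∑ s, ∑ a, (M.tr s a).card := by
    rw [← List.toFinset_card_of_nodup P.trans_nodup, ← Finset.sum_product',
      Finset.card_eq_sum_card_fiberwise (f := fun τ => (τ.1, τ.2.1))
        (t := Finset.univ ×ˢ Finset.univ) (fun _ _ => by simp)]
    refine Finset.sum_le_sum fun z _ => Finset.card_le_card_of_injOn (fun τ => τ.2.2) ?_ ?_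
    · rintro ⟨s, a, μ⟩ h
      simp only [Finset.coe_filter, List.mem_toFinset, Set.mem_ofPred_eq] at h
      obtain ⟨h, rfl⟩ := h
      exact (P.mem_trans _ _ _).1 h
    · rintro ⟨s, a, μ⟩ h ⟨s', a', μ'⟩ h' e
      simp only [Finset.coe_filter, List.mem_toFinset, Set.mem_ofPred_eq] at h h' e
      obtain ⟨-, rfl⟩ := h
      obtain ⟨-, h'⟩ := h'
      simp only [Prod.mk.injEq] at h' ⊢
      exact ⟨h'.1.symm, h'.2.symm, e⟩
  refine h1.trans (le_trans ?_ (Nat.add_le_add_right (Nat.le_add_left _ _) _))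
  unfold numEmpty
  simp only [← Finset.sum_add_distrib]
  refine Finset.sum_le_sum fun s _ => Finset.sum_le_sum fun a _ => ?_
  rw [Finset.card_filter, ← Finset.sum_add_distrib, Finset.card_eq_sum_ones]
  refine Finset.sum_le_sum fun μ hμ => ?_
  split_ifs with h
  · omega
  · push Not at h
    obtain ⟨x, hx⟩ := h
    have : 0 < (Finset.univ.filter fun x => 0 < μ x).card := Finset.card_pos.2
      ⟨x, by simpa using lt_of_le_of_ne (M.mem_unit s a μ hμ x).1 hx.symm⟩
    omega

/-- Bounds the label numbers in the input independently of the cardinality of `A`. -/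
theorem ncard_enabled_le : M.enabled.ncard ≤ P.trans.length := by
  classical
  have hsub : M.enabled ⊆ ((P.trans.map fun τ => τ.2.1).toFinset : Set A) := by
    rintro a ⟨s, μ, hμ⟩
    simp only [List.coe_toFinset, List.mem_map, Set.mem_ofPred_eq]
    exact ⟨(s, a, μ), (P.mem_trans _ _ _).2 hμ, rfl⟩
  refine (Set.ncard_le_ncard hsub (Finset.finite_toSet _)).trans ?_
  rw [Set.ncard_coe_finset]
  exact (List.toFinset_card_le _).trans (by simp)

/-- The part of the input word that describes one transition. -/
def block (P : M.Presentation) (τ : S × A × (S → ℚ)) : List ℚ :=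
  ((P.state τ.1 : ℕ) : ℚ) :: (P.label τ.2.1 : ℚ) ::
    List.ofFn fun i : Fin (Fintype.card S) => τ.2.2 (P.state.symm i)

theorem length_block (τ : S × A × (S → ℚ)) : (P.block τ).length = Fintype.card S + 2 := by
  simp [block]

variable (s t : S)

theorem length_encode : (P.encode s t).length = (P.table s t).len := by
  change ([_, _, _, _] ++ P.trans.flatMap P.block).length = 4 + P.trans.length * _
  rw [List.length_append, List.length_flatMap_of_length_eq _ fun τ _ => P.length_block τ]
  rfl

theorem encode_getElem? {j r : ℕ} (hj : j < P.trans.length) (hr : r < Fintype.card S + 2) :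
    (P.encode s t)[j * (Fintype.card S + 2) + 4 + r]? = (P.block P.trans[j])[r]? := by
  change ([_, _, _, _] ++ P.trans.flatMap P.block)[_]? = _
  rw [List.getElem?_append_right (by simp; omega),
    ← List.getElem?_flatMap_of_length_eq P.trans (fun τ _ => P.length_block τ) hj hr]
  congr 1
  simp
  omega

theorem stored_init : (P.table s t).Stored (ArithRAM.State.init (P.encode s t)).mem where
  states := by rw [ArithRAM.State.init_mem]; rfl
  transitions := by rw [ArithRAM.State.init_mem]; rfl
  fst := by rw [ArithRAM.State.init_mem]; rfl
  snd := by rw [ArithRAM.State.init_mem]; rfl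
  src j hj := by
    replace hj : j < P.trans.length := hj
    rw [ArithRAM.State.init_mem, List.getD_eq_getElem?_getD,
      show (P.table s t).N = Fintype.card S from rfl, P.encode_getElem? s t hj (by omega),
      P.table_src s t hj]
    rfl
  lab j hj := by
    replace hj : j < P.trans.length := hj
    rw [ArithRAM.State.init_mem, List.getD_eq_getElem?_getD,
      show (P.table s t).N = Fintype.card S from rfl,
      P.encode_getElem? s t (r := 1) hj (by omega), P.table_lab s t hj]
    rfl
  mu j hj x hx := by
    replace hj : j < P.trans.length := hj
    replace hx : x < Fintype.card S := hx
    obtain ⟨y, rfl⟩ : ∃ y, ((P.state y : Fin _) : ℕ) = x := ⟨P.state.symm ⟨x, hx⟩, by simp⟩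
    rw [ArithRAM.State.init_mem, List.getD_eq_getElem?_getD,
      show (P.table s t).N = Fintype.card S from rfl,
      show j * (Fintype.card S + 2) + 6 + (P.state y : ℕ) =
        j * (Fintype.card S + 2) + 4 + ((P.state y : ℕ) + 2) by omega,
      P.encode_getElem? s t hj (by omega), P.table_mu s t hj]
    unfold UnitRep
    rw [M.coe_toFuzzy (P.trans_mem hj)]
    simp [block]

theorem ratBits_le_of_mem_encode [Fintype A] {q : ℚ} (hq : q ∈ P.encode s t) :
    ratBits q ≤ (P.table s t).len + 1 + M.bitSize := by
  have hlen : (P.table s t).len = 4 + P.trans.length * (Fintype.card S + 2) := rfl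
  have hnat : ∀ m : ℕ, m ≤ (P.table s t).len + M.bitSize →
      ratBits (m : ℚ) ≤ (P.table s t).len + 1 + M.bitSize := fun m hm =>
    (ArithRAM.ratBits_natCast_le m).trans (by omega)
  have hS : Fintype.card S ≤ M.bitSize := Nat.le_add_right _ _
  have hstate : ∀ u, ratBits ((P.state u : ℕ) : ℚ) ≤ (P.table s t).len + 1 + M.bitSize :=
    fun u => hnat _ (by have := (P.state u).is_lt; omega)
  have hT : P.trans.length ≤ (P.table s t).len := by
    have := Nat.mul_le_mul_left P.trans.length (show 1 ≤ Fintype.card S + 2 by omega)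
    omega
  rw [encode, List.mem_append, List.mem_flatMap] at hq
  rcases hq with hq | ⟨⟨u, a, μ⟩, hτ, hq⟩
  · simp only [List.mem_cons, List.not_mem_nil, or_false] at hq
    rcases hq with rfl | rfl | rfl | rfl
    · exact hnat _ (by omega)
    · exact hnat _ (by omega)
    · exact hstate _
    · exact hstate _
  · have hμ := (P.mem_trans _ _ _).1 hτ
    rw [List.mem_cons, List.mem_cons, List.mem_ofFn'] at hq
    rcases hq with rfl | rfl | ⟨i, rfl⟩
    · exact hstate _
    · have h1 := P.label_lt a ⟨u, μ, hμ⟩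
      have h2 := P.ncard_enabled_le
      exact hnat _ (by change P.label a ≤ _; omega)
    · exact (M.ratBits_le_bitSize hμ _).trans (by omega)

theorem bounded_init [Fintype A] {K B : ℕ} (hF : (P.table s t).Fits K B) (hB : K + 2 + M.bitSize ≤ B) :
    (ArithRAM.State.init (P.encode s t)).Bounded K B := by
  obtain ⟨hK, -⟩ := hF
  have h2 : ratBits 0 = 1 := by decide
  refine ⟨fun r hr => ?_, fun k hk => ?_, fun r => ?_, fun k => ?_⟩
  · by_contra h
    exact hr (Finsupp.single_eq_of_ne (by omega))
  · by_contra h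
    rw [ArithRAM.State.init_mem, List.getD_eq_default _ _ (by rw [length_encode]; omega)] at hk
    exact hk rfl
  · simp only [ArithRAM.State.init, Finsupp.single_apply]
    split_ifs
    · rw [length_encode]
      exact (ArithRAM.ratBits_natCast_le _).trans (by omega)
    · omega
  · rw [ArithRAM.State.init_mem]
    rcases lt_or_ge k (P.encode s t).length with h | h
    · rw [List.getD_eq_getElem _ _ h]
      exact (P.ratBits_le_of_mem_encode s t (List.getElem_mem h)).trans (by omega)
    · rw [List.getD_eq_default _ _ h]
      omega

end Presentation

end RatFTS

/-! ### Polynomial bounds and the main theorem -/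

/-- The diagonal suffices: the time is monotone, and one size parameter bounds both the states and
the transitions. -/
theorem exists_polynomial_mainTime :
    ∃ p : Polynomial ℕ, ∀ n, p.eval n = TransTable.mainTime n n := by
  open Polynomial TransTable in
  obtain ⟨h, hh⟩ : ∃ h : Polynomial ℕ, ∀ n, h.eval n = halfTime n :=
    ⟨2 + X * ((4 + (1 + ((2 + X * (13 + 2)) + 2))) + 2), fun n => by simp [halfTime]⟩
  open Polynomial TransTable in
  obtain ⟨g, hg⟩ : ∃ g : Polynomial ℕ, ∀ n, g.eval n = gapTime n n :=
    ⟨1 + (2 + X * ((4 + ((4 + (((1 + (h + h)) + 2) + 1)) + 1)) + 2)),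
      fun n => by simp [gapTime, hh]⟩
  open Polynomial TransTable in
  obtain ⟨r, hr⟩ : ∃ r : Polynomial ℕ, ∀ n, r.eval n = roundTime n n :=
    ⟨2 + X * ((4 + (4 + (2 + X * ((g + (9 + 9)) + 2)))) + 2), fun n => by simp [roundTime, hg]⟩
  open Polynomial TransTable in
  exact ⟨10 + ((2 + X * X * (4 + X * (X + 2)) * (r + 2)) + 9), fun n => by simp [mainTime, hr]⟩

theorem mainTime_mono {N T n : ℕ} (hN : N ≤ n) (hT : T ≤ n) :
    TransTable.mainTime N T ≤ TransTable.mainTime n n := by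
  unfold TransTable.mainTime TransTable.roundTime TransTable.gapTime TransTable.halfTime
  gcongr

/-- A bound on the addresses that are used on a system with `N` states and `T` transitions. -/
def addressBound (N T : ℕ) : ℕ :=
  N * N * (4 + T * (N + 2)) + (4 + T * (N + 2)) + N * N + 10

theorem exists_polynomial_spaceBound :
    ∃ q : Polynomial ℕ, ∀ n,
      q.eval n = ArithRAM.spaceBound (addressBound n n) (addressBound n n + 2 + n) := by
  open Polynomial in
  obtain ⟨h, hh⟩ : ∃ h : Polynomial ℕ, ∀ n, h.eval n = addressBound n n :=
    ⟨X * X * (4 + X * (X + 2)) + (4 + X * (X + 2)) + X * X + 10, fun n => by simp [addressBound]⟩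
  open Polynomial in
  exact ⟨40 * (40 + (h + 2 + X)) + h * (h + (h + 2 + X)), fun n => by
    simp [ArithRAM.spaceBound, hh]⟩

theorem spaceBound_mono {N T b n : ℕ} (hN : N ≤ n) (hT : T ≤ n) (hb : b ≤ n) :
    ArithRAM.spaceBound (addressBound N T) (addressBound N T + 2 + b) ≤
      ArithRAM.spaceBound (addressBound n n) (addressBound n n + 2 + n) := by
  unfold ArithRAM.spaceBound addressBound
  gcongr

theorem mainTheorem1 :
    ∃ (prog : ArithRAM.Program) (p q : Polynomial ℕ),
      ∀ (S : Type*) (A : Type*) [Fintype S] [Fintype A] (M : RatFTS S A)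
        (P : M.Presentation) (s t : S),
        ∃ (σ : ArithRAM.State) (n b : ℕ),
          ArithRAM.Run prog (ArithRAM.State.init (P.encode s t)) σ n b ∧
          ((σ.reg 0 : ℚ) : ℝ) = (M.toFTS.behDist 1 s t : ℝ) ∧
          n ≤ p.eval (M.size + M.numEmpty) ∧
          b ≤ q.eval (M.bitSize + M.numEmpty) := by
  obtain ⟨p, hp⟩ := exists_polynomial_mainTime
  obtain ⟨q, hq⟩ := exists_polynomial_spaceBound
  refine ⟨TransTable.mainProg, p, q, fun S A _ _ M P s t => ?_⟩
  -- The least address bound that fits; the summand `M.bitSize` makes room for the degrees in the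
  -- input.
  have hF : (P.table s t).Fits (addressBound (Fintype.card S) P.trans.length)
      (addressBound (Fintype.card S) P.trans.length + 2 + M.bitSize) :=
    ⟨le_rfl, Nat.le_add_right _ _⟩
  have hN : Fintype.card S ≤ M.size := Nat.le_add_right _ _
  have hT := P.length_trans_le
  have hb := M.size_le_bitSize
  obtain ⟨σ, n, b, h1, h2, h3, -, h4⟩ := TransTable.exec_mainProg hF (P.leastClosed_distMatrix s t)
    (P.stored_init s t) (by simp [ArithRAM.State.init, P.length_encode])
    (by simp [ArithRAM.State.init])
    (fun k hk => by
      rw [ArithRAM.State.init_mem, List.getD_eq_default _ _ (by rwa [P.length_encode])])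
    (P.bounded_init s t hF le_rfl)
  refine ⟨σ, n, b, h1, ?_, ?_, ?_⟩
  · refine Eq.trans h4 ?_
    congr 1
    simp [RatFTS.Presentation.distMatrix, RatFTS.Presentation.table]
  · rw [hp]
    exact h2.trans (mainTime_mono (by change Fintype.card S ≤ _; omega) hT)
  · rw [hq]
    exact h3.trans (spaceBound_mono (by omega) (by omega) (by omega))
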